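/- **Conventions.** A quandle is a set $X$ with a binary operation $\rhd$ such that $x\rhd x=x$, every map $y\mapsto y\rhd x$ is a bijection, and $(x\rhd y)\rhd z=(x\rhd z)\rhd(y\rhd z)$. For a commutative ring $k$ let $C^R_i(X;k)$ be the free $k$-module on $X^i$ for $i\ge 1$, and let $C^R_0(X;k)=0$, with differential, for $i>1$, $$\partial_i(x_1,\dots,x_i)=\sum_{j=2}^{i}(-1)^j\big((x_1,\dots,x_{j-1},x_{j+1},\dots,x_i)-(x_1\rhd x_j,\dots,x_{j-1}\rhd x_j,x_{j+1},\dots,x_i)\big)$$ (and $\partial_1=0$). Let $C^Q_\bullet(X;k)$ be the quotient of $C^R_\bullet(X;k)$ by the subcomplex spanned by the tuples with $x_j=x_{j+1}$ for some $j$. The rack homology $H^R_i(X;k)$ and the quandle homology $H^Q_i(X;k)$ are the homology modules of these two complexes. A partition is primitive if none of its parts equals $1$. For a primitive partition $\lambda$ of $m$ (written $|\lambda|=m$) and $n\ge m$, let $c^n_\lambda\subseteq\mathfrak S_n$ be the conjugacy class of the permutations whose cycle lengths are the parts of $\lambda$ together with $n-m$ ones; for $n<m$ let $c^n_\lambda=\emptyset$.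 For a finite set $\boldsymbol\lambda$ of primitive partitions let $c^n_{\boldsymbol\lambda}=\bigcup_{\lambda\in\boldsymbol\lambda}c^n_\lambda$, a quandle under $x\rhd y=yxy^{-1}$, and let $|\boldsymbol\lambda|=\max_{\lambda\in\boldsymbol\lambda}|\lambda|$ (and $0$ if $\boldsymbol\lambda$ is empty). **Corollary 3.2.** Let $\boldsymbol\lambda$ be a finite set of primitive partitions, let $i\ge 0$ be an integer, and let $k$ be a commutative Noetherian ring. 1. If $k$ is a field, then there exist polynomials $p_{R,i}(T),p_{Q,i}(T)\in\mathbb Q[T]$ of degree $\le i\cdot|\boldsymbol\lambda|$ such that for all $n\gg 0$ the following spaces are finite-dimensional and $$p_{R,i}(n)=\dim_k H^R_i(c^n_{\boldsymbol\lambda};k),\qquad p_{Q,i}(n)=\dim_k H^Q_i(c^n_{\boldsymbol\lambda};k).$$ 2. Let $\mathfrak a_{R,i,n},\mathfrak a_{Q,i,n}\subseteq k$ be the ideals generated by the non-zero-divisors of $k$ that annihilate $H^R_i(c^n_{\boldsymbol\lambda};k)$ and $H^Q_i(c^n_{\boldsymbol\lambda};k)$, respectively. Then for $n\gg 0$ the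 ideals $\mathfrak a_{R,i,n}$ and $\mathfrak a_{Q,i,n}$ are independent of $n$. In particular, for $k=\mathbb Z$ there exist integers $e_{R,i}$ and $e_{Q,i}$, independent of $n$, that are the exponents of the abelian groups $H^R_i(c^n_{\boldsymbol\lambda};\mathbb Z)$ and $H^Q_i(c^n_{\boldsymbol\lambda};\mathbb Z)$, respectively, for all $n\gg 0$. Here the exponent of a group annihilated by no positive integer is $0$; likewise, the exponents of the torsion subgroups of these two groups are positive and independent of $n$ for $n\gg 0$. -/

import Mathlib

namespace RackQuandle

/-! ### Rack and quandle homology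

Mathlib's racks act from the left: `Shelf.act x y` is the element written `y ▷ x` in the
right-handed convention, in which `(x ▷ y) ▷ z = (x ▷ z) ▷ (y ▷ z)` and `· ▷ x` is bijective. -/

/-- The operation `x ▷ y` of a rack, in the right-handed convention. -/
def rop {X : Type*} [Rack X] (x y : X) : X := Shelf.act y x

/-- The basis of the `i`-th chain group: `X ^ i` for `i ≥ 1`, and the empty set for `i = 0`
(the complex is zero in degree `0`). -/
def Tuples (X : Type*) : ℕ → Type _
  | 0 => PEmpty
  | i + 1 => Fin (i + 1) → X

/-- `C_i^R(X; k)`: the free `k`-module on `X ^ i` for `i ≥ 1`, and `0` for `i = 0`. -/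
abbrev RackChain (k : Type*) [CommRing k] (X : Type*) (i : ℕ) : Type _ := Tuples X i →₀ k

/-- `(x_1, …, x_{j-1}, x_{j+1}, …, x_{i+1})`: the entry at `j` is omitted. -/
def omitEntry {X : Type*} {i : ℕ} (v : Fin (i + 1) → X) (j : Fin (i + 1)) : Fin i → X :=
  fun t => if t.castSucc < j then v t.castSucc else v t.succ

/-- `(x_1 ▷ x_j, …, x_{j-1} ▷ x_j, x_{j+1}, …, x_{i+1})`. -/
def actEntry {X : Type*} [Rack X] {i : ℕ} (v : Fin (i + 1) → X) (j : Fin (i + 1)) : Fin i → X :=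
  fun t => if t.castSucc < j then rop (v t.castSucc) (v j) else v t.succ

/-- The basis vector of a tuple of length `i + 1`. -/
noncomputable def tup (k : Type*) [CommRing k] {X : Type*} {i : ℕ} (v : Fin (i + 1) → X) :
    RackChain k X (i + 1) :=
  Finsupp.single (show Tuples X (i + 1) from v) 1

/-- The value of the differential on a tuple of length `i + 2`. Entries are numbered from `0`
here, so that `j.succ` is the entry with number `j + 2` when counting from `1`; thus
the sum is over the entries with number `≥ 2`, with sign `(-1) ^ number`. -/
noncomputable def boundaryTuple (k : Type*) [CommRing k] {X : Type*} [Rack X] {i : ℕ}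
    (v : Fin (i + 2) → X) : RackChain k X (i + 1) :=
  ∑ j : Fin (i + 1),
    ((-1 : k) ^ ((j : ℕ) + 2)) • (tup k (omitEntry v j.succ) - tup k (actEntry v j.succ))

/-- The differential `C_{i+1}^R(X; k) → C_i^R(X; k)`. -/
noncomputable def rackBoundary (k : Type*) [CommRing k] (X : Type*) [Rack X] :
    (i : ℕ) → RackChain k X (i + 1) →ₗ[k] RackChain k X i
  | 0 => 0
  | i + 1 => Finsupp.linearCombination k
      (fun v : Tuples X (i + 2) => boundaryTuple k (show Fin (i + 2) → X from v))

theorem omit_omit {X : Type*} {i : ℕ} (v : Fin (i + 2) → X) (l j : Fin (i + 1)) (h : l ≤ j) :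
    omitEntry (omitEntry v j.succ) l = omitEntry (omitEntry v l.castSucc) j := by
  funext t
  obtain ⟨t, ht⟩ := t; obtain ⟨l, hl⟩ := l; obtain ⟨j, hj⟩ := j
  simp only [omitEntry, Fin.lt_def, Fin.le_def, Fin.castSucc_mk, Fin.succ_mk] at h ⊢
  split_ifs <;> first | rfl | omega

theorem act_act {X : Type*} [Rack X] {i : ℕ} (v : Fin (i + 2) → X) (l j : Fin (i + 1))
    (h : l ≤ j) : actEntry (actEntry v j.succ) l = actEntry (actEntry v l.castSucc) j := by
  funext t
  obtain ⟨t, ht⟩ := t; obtain ⟨l, hl⟩ := l; obtain ⟨j, hj⟩ := j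
  simp only [actEntry, Fin.lt_def, Fin.le_def, Fin.castSucc_mk, Fin.succ_mk] at h ⊢
  split_ifs <;> first | rfl | omega | exact (Shelf.self_distrib (α := X)).symm

theorem omit_act {X : Type*} [Rack X] {i : ℕ} (v : Fin (i + 2) → X) (l j : Fin (i + 1))
    (h : l ≤ j) : omitEntry (actEntry v j.succ) l = actEntry (omitEntry v l.castSucc) j := by
  funext t
  obtain ⟨t, ht⟩ := t; obtain ⟨l, hl⟩ := l; obtain ⟨j, hj⟩ := j
  simp only [omitEntry, actEntry, Fin.lt_def, Fin.le_def, Fin.castSucc_mk, Fin.succ_mk] at h ⊢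
  split_ifs <;> first | rfl | omega

theorem act_omit {X : Type*} [Rack X] {i : ℕ} (v : Fin (i + 2) → X) (l j : Fin (i + 1))
    (h : l ≤ j) : actEntry (omitEntry v j.succ) l = omitEntry (actEntry v l.castSucc) j := by
  funext t
  obtain ⟨t, ht⟩ := t; obtain ⟨l, hl⟩ := l; obtain ⟨j, hj⟩ := j
  simp only [omitEntry, actEntry, Fin.lt_def, Fin.le_def, Fin.castSucc_mk, Fin.succ_mk] at h ⊢
  split_ifs <;> first | rfl | omega

theorem alternating_sum_eq_zero (k : Type*) [CommRing k] {M : Type*} [AddCommGroup M] [Module k M]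
    {n : ℕ} (G : Fin (n + 2) → Fin (n + 1) → M)
    (hG : ∀ l j : Fin (n + 1), l ≤ j → G j.succ l = G l.castSucc j) :
    ∑ j : Fin (n + 2), ∑ l : Fin (n + 1), ((-1 : k) ^ ((j : ℕ) + (l : ℕ))) • G j l = 0 := by
  rw [← Finset.sum_product' Finset.univ Finset.univ
    (fun (j : Fin (n + 2)) (l : Fin (n + 1)) => ((-1 : k) ^ ((j : ℕ) + (l : ℕ))) • G j l)]
  refine Finset.sum_involution (fun p _ =>
    if h : p.2.castSucc < p.1 then
      (p.2.castSucc, p.1.pred (Fin.ne_zero_of_lt h))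
    else (p.2.succ, p.1.castPred (Fin.ne_last_of_lt
      (lt_of_le_of_lt (not_lt.1 h) (Fin.castSucc_lt_succ (i := p.2)))))) ?_ ?_ ?_ ?_
  · rintro ⟨j, l⟩ -
    by_cases h : l.castSucc < j
    · obtain ⟨j, rfl⟩ := Fin.exists_succ_eq.2 (Fin.ne_zero_of_lt h)
      have hl : l ≤ j := by simpa [Fin.le_castSucc_iff, Fin.lt_def, Nat.lt_succ_iff] using h
      simp only [h, dif_pos, Fin.pred_succ, hG l j hl, Fin.val_succ, Fin.val_castSucc, ← add_smul]
      rw [show (j : ℕ) + 1 + l = (l + j) + 1 by ring, pow_succ]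
      simp
    · have hlast : j ≠ Fin.last _ := Fin.ne_last_of_lt
        (lt_of_le_of_lt (not_lt.1 h) (Fin.castSucc_lt_succ (i := l)))
      obtain ⟨j, rfl⟩ := Fin.exists_castSucc_eq.2 hlast
      have hl : j ≤ l := by simpa using h
      simp only [h, dif_neg, not_false_iff, Fin.castPred_castSucc, hG j l hl, Fin.val_succ,
        Fin.val_castSucc, ← add_smul]
      rw [show (l : ℕ) + 1 + j = (j + l) + 1 by ring, pow_succ]
      simp
  · rintro ⟨j, l⟩ - - h
    by_cases h' : l.castSucc < j
    · simp only [h', dif_pos, Prod.mk.injEq] at h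
      exact h'.ne h.1
    · simp only [h', dif_neg, not_false_iff, Prod.mk.injEq] at h
      exact h' (h.1 ▸ Fin.castSucc_lt_succ)
  · intros; exact Finset.mem_univ _
  · rintro ⟨j, l⟩ -
    by_cases h : l.castSucc < j
    · obtain ⟨j, rfl⟩ := Fin.exists_succ_eq.2 (Fin.ne_zero_of_lt h)
      have hl : l ≤ j := by simpa [Fin.le_castSucc_iff, Fin.lt_def, Nat.lt_succ_iff] using h
      simp [h, hl]
    · have hlast : j ≠ Fin.last _ := Fin.ne_last_of_lt
        (lt_of_le_of_lt (not_lt.1 h) (Fin.castSucc_lt_succ (i := l)))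
      obtain ⟨j, rfl⟩ := Fin.exists_castSucc_eq.2 hlast
      have hl : j ≤ l := by simpa using h
      simp [h, hl]

/-- The terms of the differential with `j = 1` (counting from `1`) would cancel. -/
theorem boundaryTuple_eq_sum (k : Type*) [CommRing k] {X : Type*} [Rack X] {i : ℕ}
    (v : Fin (i + 2) → X) : boundaryTuple k v =
      ∑ j : Fin (i + 2),
        ((-1 : k) ^ ((j : ℕ) + 1)) • (tup k (omitEntry v j) - tup k (actEntry v j)) := by
  have h0 : omitEntry v 0 = actEntry v 0 := by
    funext t; simp [omitEntry, actEntry]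
  rw [Fin.sum_univ_succ, h0, sub_self, smul_zero, zero_add]
  rfl

theorem rackBoundary_tup (k : Type*) [CommRing k] {X : Type*} [Rack X] {i : ℕ}
    (v : Fin (i + 2) → X) : rackBoundary k X (i + 1) (tup k v) = boundaryTuple k v := by
  exact (Finsupp.linearCombination_single k (1 : k) _).trans (one_smul k _)

/-- The rack complex is a complex. -/
theorem rackBoundary_comp (k : Type*) [CommRing k] (X : Type*) [Rack X] (i : ℕ) :
    rackBoundary k X i ∘ₗ rackBoundary k X (i + 1) = 0 := by
  cases i with
  | zero => ext; simp [rackBoundary]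
  | succ i =>
    refine Finsupp.lhom_ext' fun v => LinearMap.ext_ring ?_
    change rackBoundary k X (i + 1) (rackBoundary k X (i + 2)
      (tup k (show Fin (i + 3) → X from v))) = 0
    generalize (show Fin (i + 3) → X from v) = w
    rw [rackBoundary_tup, boundaryTuple_eq_sum]
    simp only [map_sum, map_smul, map_sub, rackBoundary_tup]
    rw [← alternating_sum_eq_zero k (fun (j : Fin (i + 3)) (l : Fin (i + 2)) =>
      (tup k (omitEntry (omitEntry w j) l) - tup k (actEntry (omitEntry w j) l)) -
      (tup k (omitEntry (actEntry w j) l) - tup k (actEntry (actEntry w j) l)))]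
    · refine Finset.sum_congr rfl fun j _ => ?_
      rw [boundaryTuple_eq_sum, boundaryTuple_eq_sum, ← Finset.sum_sub_distrib, Finset.smul_sum]
      refine Finset.sum_congr rfl fun l _ => ?_
      rw [← smul_sub, smul_smul, ← pow_add,
        show (j : ℕ) + 1 + ((l : ℕ) + 1) = (j + l) + 2 by ring, pow_add]
      simp
    · intro l j h
      rw [omit_omit w l j h, act_omit w l j h, omit_act w l j h, act_act w l j h]
      abel

/-- The cycles in degree `i` of the rack complex. -/
noncomputable def rackCycles (k : Type*) [CommRing k] (X : Type*) [Rack X] :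
    (i : ℕ) → Submodule k (RackChain k X i)
  | 0 => ⊤
  | i + 1 => LinearMap.ker (rackBoundary k X i)

/-- The quotient `Z / (Z ∩ B)` of submodules `Z`, `B` of a module; it is `Z / B` if `B ≤ Z`. -/
abbrev SubQuotient {k : Type*} [CommRing k] {M : Type*} [AddCommGroup M] [Module k M]
    (Z B : Submodule k M) : Type _ :=
  Z ⧸ B.submoduleOf Z

/-- Rack homology `H_i^R(X; k)`: cycles modulo boundaries. -/
abbrev RackHomology (k : Type*) [CommRing k] (X : Type*) [Rack X] (i : ℕ) : Type _ :=
  SubQuotient (rackCycles k X i) (LinearMap.range (rackBoundary k X i))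

/-- The tuples `(x_1, …, x_i)` with `x_j = x_{j+1}` for some `j`. -/
def degenerateTuples (X : Type*) : (i : ℕ) → Set (Tuples X i)
  | 0 => ∅
  | i + 1 => {v : Fin (i + 1) → X | ∃ j : Fin i, v j.castSucc = v j.succ}

/-- The submodule of `C_i^R(X; k)` generated by the degenerate tuples. -/
noncomputable def degenerate (k : Type*) [CommRing k] (X : Type*) (i : ℕ) :
    Submodule k (RackChain k X i) :=
  Submodule.span k ((fun v => Finsupp.single v (1 : k)) '' degenerateTuples X i)

theorem tup_mem_degenerate (k : Type*) [CommRing k] {X : Type*} {i : ℕ} (v : Fin (i + 1) → X)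
    (h : ∃ j : Fin i, v j.castSucc = v j.succ) : tup k v ∈ degenerate k X (i + 1) :=
  Submodule.subset_span ⟨v, h, rfl⟩

theorem omitEntry_degenerate {X : Type*} {i : ℕ} (v : Fin (i + 2) → X) (a : Fin (i + 1))
    (h : v a.castSucc = v a.succ) (j : Fin (i + 2)) (h1 : j ≠ a.castSucc) (h2 : j ≠ a.succ) :
    ∃ c : Fin i, omitEntry v j c.castSucc = omitEntry v j c.succ := by
  obtain ⟨a, ha⟩ := a
  obtain ⟨j, hj⟩ := j
  simp only [Fin.castSucc_mk, Fin.succ_mk, ne_eq, Fin.mk.injEq] at h h1 h2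
  rcases lt_or_gt_of_ne h1 with hlt | hgt
  · refine ⟨⟨a - 1, by omega⟩, ?_⟩
    obtain ⟨b, rfl⟩ : ∃ b, a = b + 1 := ⟨a - 1, by omega⟩
    have e1 : ¬ b < j := by omega
    have e2 : ¬ b + 1 < j := by omega
    simpa [omitEntry, e1, e2] using h
  · have e1 : a < j := by omega
    have e2 : a + 1 < j := by omega
    refine ⟨⟨a, by omega⟩, ?_⟩
    simpa [omitEntry, e1, e2] using h

theorem actEntry_degenerate {X : Type*} [Rack X] {i : ℕ} (v : Fin (i + 2) → X) (a : Fin (i + 1))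
    (h : v a.castSucc = v a.succ) (j : Fin (i + 2)) (h1 : j ≠ a.castSucc) (h2 : j ≠ a.succ) :
    ∃ c : Fin i, actEntry v j c.castSucc = actEntry v j c.succ := by
  obtain ⟨a, ha⟩ := a
  obtain ⟨j, hj⟩ := j
  simp only [Fin.castSucc_mk, Fin.succ_mk, ne_eq, Fin.mk.injEq] at h h1 h2
  rcases lt_or_gt_of_ne h1 with hlt | hgt
  · refine ⟨⟨a - 1, by omega⟩, ?_⟩
    obtain ⟨b, rfl⟩ : ∃ b, a = b + 1 := ⟨a - 1, by omega⟩
    have e1 : ¬ b < j := by omega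
    have e2 : ¬ b + 1 < j := by omega
    simpa [actEntry, e1, e2] using h
  · have e1 : a < j := by omega
    have e2 : a + 1 < j := by omega
    refine ⟨⟨a, by omega⟩, ?_⟩
    simp [actEntry, e1, e2, h]

theorem omitEntry_pair {X : Type*} {i : ℕ} (v : Fin (i + 2) → X) (a : Fin (i + 1))
    (h : v a.castSucc = v a.succ) : omitEntry v a.castSucc = omitEntry v a.succ := by
  funext t
  rcases lt_trichotomy t a with hlt | rfl | hgt
  · have e1 : (t : ℕ) < a := hlt
    have e2 : (t : ℕ) < a + 1 := by omega
    simp [omitEntry, Fin.lt_def, e1, e2]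
  · simp [omitEntry, Fin.lt_def, h]
  · have e1 : ¬ (t : ℕ) < a := by have : (a : ℕ) < t := hgt; omega
    have e2 : ¬ (t : ℕ) < a + 1 := by have : (a : ℕ) < t := hgt; omega
    simp [omitEntry, Fin.lt_def, e1, e2]

theorem actEntry_pair {X : Type*} [Quandle X] {i : ℕ} (v : Fin (i + 2) → X) (a : Fin (i + 1))
    (h : v a.castSucc = v a.succ) : actEntry v a.castSucc = actEntry v a.succ := by
  funext t
  rcases lt_trichotomy t a with hlt | rfl | hgt
  · have e1 : (t : ℕ) < a := hlt
    have e2 : (t : ℕ) < a + 1 := by omega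
    simp [actEntry, Fin.lt_def, e1, e2, h]
  · simp [actEntry, Fin.lt_def, h, rop]
  · have e1 : ¬ (t : ℕ) < a := by have : (a : ℕ) < t := hgt; omega
    have e2 : ¬ (t : ℕ) < a + 1 := by have : (a : ℕ) < t := hgt; omega
    simp [actEntry, Fin.lt_def, e1, e2]

theorem boundaryTuple_mem_degenerate (k : Type*) [CommRing k] {X : Type*} [Quandle X] {i : ℕ}
    (v : Fin (i + 2) → X) (h : ∃ j : Fin (i + 1), v j.castSucc = v j.succ) :
    boundaryTuple k v ∈ degenerate k X (i + 1) := by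
  obtain ⟨a, ha⟩ := h
  let g : Fin (i + 2) → RackChain k X (i + 1) := fun j =>
    ((-1 : k) ^ ((j : ℕ) + 1)) • (tup k (omitEntry v j) - tup k (actEntry v j))
  have h0 : g 0 = 0 := by
    have : omitEntry v 0 = actEntry v 0 := by
      funext t; simp [omitEntry, actEntry]
    simp [g, this]
  have hsum : boundaryTuple k v = ∑ j, g j := by
    rw [Fin.sum_univ_succ, h0, zero_add]
    rfl
  have hne : a.succ ∈ Finset.univ.erase a.castSucc := by
    simp [Fin.ext_iff]
  have hpair : g a.castSucc + g a.succ = 0 := by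
    simp only [g, omitEntry_pair v a ha, actEntry_pair v a ha, ← add_smul]
    simp [pow_succ]
  rw [hsum, ← Finset.add_sum_erase _ g (Finset.mem_univ a.castSucc),
    ← Finset.add_sum_erase _ g hne, ← add_assoc, hpair, zero_add]
  refine Submodule.sum_mem _ fun j hj => ?_
  simp only [Finset.mem_erase, Finset.mem_univ, and_true] at hj
  exact Submodule.smul_mem _ _ (Submodule.sub_mem _
    (tup_mem_degenerate k _ (omitEntry_degenerate v a ha j hj.2 hj.1))
    (tup_mem_degenerate k _ (actEntry_degenerate v a ha j hj.2 hj.1)))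

/-- The differential of the rack complex of a quandle preserves degenerate chains. -/
theorem degenerate_le_comap (k : Type*) [CommRing k] (X : Type*) [Quandle X] (i : ℕ) :
    degenerate k X (i + 1) ≤ (degenerate k X i).comap (rackBoundary k X i) := by
  refine Submodule.span_le.2 ?_
  rintro _ ⟨v, hv, rfl⟩
  cases i with
  | zero => simp [rackBoundary]
  | succ i =>
    have h := boundaryTuple_mem_degenerate k (X := X) (i := i) v hv
    simpa [rackBoundary] using h

/-- `C_i^Q(X; k)`: the quotient of `C_i^R(X; k)` by the degenerate tuples. -/
abbrev QuandleChain (k : Type*) [CommRing k] (X : Type*) (i : ℕ) : Type _ :=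
  RackChain k X i ⧸ degenerate k X i

/-- The induced differential `C_{i+1}^Q(X; k) → C_i^Q(X; k)`. -/
noncomputable def quandleBoundary (k : Type*) [CommRing k] (X : Type*) [Quandle X] (i : ℕ) :
    QuandleChain k X (i + 1) →ₗ[k] QuandleChain k X i :=
  Submodule.mapQ (degenerate k X (i + 1)) (degenerate k X i) (rackBoundary k X i)
    (degenerate_le_comap k X i)

/-- The quandle complex is a complex. -/
theorem quandleBoundary_comp (k : Type*) [CommRing k] (X : Type*) [Quandle X] (i : ℕ) :
    quandleBoundary k X i ∘ₗ quandleBoundary k X (i + 1) = 0 := by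
  refine Submodule.linearMap_qext _ (LinearMap.ext fun c => ?_)
  have h : rackBoundary k X i (rackBoundary k X (i + 1) c) = 0 :=
    LinearMap.congr_fun (rackBoundary_comp k X i) c
  simp [quandleBoundary, h]

/-- The cycles in degree `i` of the quandle complex. -/
noncomputable def quandleCycles (k : Type*) [CommRing k] (X : Type*) [Quandle X] :
    (i : ℕ) → Submodule k (QuandleChain k X i)
  | 0 => ⊤
  | i + 1 => LinearMap.ker (quandleBoundary k X i)

/-- Quandle homology `H_i^Q(X; k)`: cycles modulo boundaries. -/
abbrev QuandleHomology (k : Type*) [CommRing k] (X : Type*) [Quandle X] (i : ℕ) : Type _ :=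
  SubQuotient (quandleCycles k X i) (LinearMap.range (quandleBoundary k X i))

/-! ### The conjugation quandles of the symmetric groups -/

/-- Integer partitions, not necessarily of the same integer. -/
abbrev Par : Type := Σ m : ℕ, Nat.Partition m

/-- A partition is primitive if it has no part equal to `1`. -/
def IsPrimitive (l : Par) : Prop := 1 ∉ l.2.parts

/-- `|Λ| = max {|l| : l ∈ Λ}` (and `0` if `Λ` is empty). -/
def parSize (Λ : Finset Par) : ℕ := Λ.sup fun l => l.1

/-- `c_l^n ⊆ S_n`: for `n ≥ m = |l|`, the permutations whose cycle lengths (fixed points included)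
are the parts of `l` together with `n - m` further parts `1`; for `n < m`, the empty set. -/
def conjClass (l : Par) (n : ℕ) : Set (Equiv.Perm (Fin n)) :=
  {σ | l.1 ≤ n ∧ σ.partition.parts = l.2.parts + Multiset.replicate (n - l.1) 1}

/-- `c_Λ^n`: the union of the classes `c_l^n`, for `l ∈ Λ`. -/
def SymClass (Λ : Finset Par) (n : ℕ) : Type :=
  {σ : Equiv.Perm (Fin n) // ∃ l ∈ Λ, σ ∈ conjClass l n}

theorem conj_mem {Λ : Finset Par} {n : ℕ} (g : Equiv.Perm (Fin n)) {σ : Equiv.Perm (Fin n)}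
    (h : ∃ l ∈ Λ, σ ∈ conjClass l n) : ∃ l ∈ Λ, g * σ * g⁻¹ ∈ conjClass l n := by
  obtain ⟨l, hl, hn, hσ⟩ := h
  refine ⟨l, hl, hn, ?_⟩
  rw [← hσ, ← Equiv.Perm.partition_eq_of_isConj.1 (isConj_iff.2 ⟨g, rfl⟩)]

/-- The quandle structure on `c_Λ^n` by conjugation, `x ▷ y = y x y⁻¹`. -/
instance symClassQuandle (Λ : Finset Par) (n : ℕ) : Quandle (SymClass Λ n) where
  act y x := ⟨y.1 * x.1 * y.1⁻¹, conj_mem y.1 x.2⟩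
  self_distrib := by
    intro x y z
    apply Subtype.ext
    simp [mul_assoc]
  invAct y x := ⟨y.1⁻¹ * x.1 * y.1, by simpa using conj_mem y.1⁻¹ x.2⟩
  left_inv := by
    intro y x
    apply Subtype.ext
    simp [mul_assoc]
  right_inv := by
    intro y x
    apply Subtype.ext
    simp [mul_assoc]
  fix := by
    intro x
    apply Subtype.ext
    simp

/-! ### Annihilators -/

/-- The ideal of `k` generated by the non-zero-divisors that annihilate the module `M`. -/
def nzdAnnihilator (k : Type*) [CommRing k] (M : Type*) [AddCommGroup M] [Module k M] : Ideal k :=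
  Ideal.span {r : k | r ∈ nonZeroDivisors k ∧ ∀ x : M, r • x = 0}

end RackQuandle

open RackQuandle

/-!
An order embedding `Fin m ↪o Fin n` extends permutations of `Fin m` by fixed points to permutations
of `Fin n`. This embeds the quandle `c_Λ^m` into `c_Λ^n` and acts on the rack and quandle complexes,
so that in each degree `i` cycles and boundaries are families, indexed by `n`, of submodules of the
chain modules `C_i^R(c_Λ^n; k)` closed under the action of order embeddings (`IsOISubmodule`; `OI`
is the category of the sets `Fin n` with order embeddings). For quandle homology one takes the
preimages of the cycles and boundaries of the quotient complex.

The basis of these chain modules is easy to understand: an `i`-tuple of permutations is obtained, in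
a unique way, from a tuple of permutations of `Fin d` without common fixed point and an order
embedding `Fin d ↪o Fin n`, and `d ≤ i * |Λ|` because a permutation in `c_Λ^n` moves at most `|Λ|`
points. Hence the basis is a finite disjoint union of representable functors (`tupleOISet`). An
order embedding is described by the vector of its gaps, and factors through another one if and only
if the gaps dominate. In this way basis elements behave like monomials, and the theory of Gröbner
bases applies, with respect to a linear order for which order embeddings act by monotone maps:

* divisibility is a well-quasi-order by Dickson's lemma (`FreeOISet.wellQuasiOrdered_divides`), so
  over a Noetherian ring every family of submodules as above is generated by its member at some
  `n = N` from there on (`exists_generation_bound`);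
* over a field, the dimension of a submodule is the number of its leading basis elements, and these
  form an upper set. By induction on the number of variables, the generating function of an upper
  set of vectors is rational with denominator a power of `1 - X` (`hilbertCount_rational`), so the
  number is eventually a polynomial in `n` of degree at most `i * |Λ|` (`finrank_eventually_poly`).

The dimension of homology is the difference of two such polynomials. If the cycles are generated
from `n = N` on, a scalar that annihilates the homology for some `n ≥ N` does so for all larger `n`;
the annihilators thus form an ascending chain of ideals, which is stationary
(`colonIdeal_eventually_const`). The torsion subgroup is the homology of the submodule of those
cycles that a nonzero integer multiplies into the boundaries (`saturation`), and the same
argument applies.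
-/

open RackQuandle
universe u

namespace RackQuandle

/-! ### Hilbert functions of upper sets of vectors -/

/-- The Hilbert function of a set `U` of vectors of natural numbers: the number of vectors in `U`
with coordinate sum `N`. -/
noncomputable def hilbertCount {s : ℕ} (U : Set (Fin s → ℕ)) (N : ℕ) : ℕ :=
  {g | g ∈ U ∧ ∑ i, g i = N}.ncard

theorem finite_sum_eq {s : ℕ} (N : ℕ) : {g : Fin s → ℕ | ∑ i, g i = N}.Finite :=
  (Finset.Nat.antidiagonalTuple s N).finite_toSet.subset fun _ hg =>
    Finset.Nat.mem_antidiagonalTuple.2 hg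

theorem hilbertCount_succ {s : ℕ} (U : Set (Fin (s + 1) → ℕ)) (N : ℕ) :
    hilbertCount U N = ∑ x ∈ Finset.HasAntidiagonal.antidiagonal N,
      hilbertCount {g : Fin s → ℕ | Fin.cons x.1 g ∈ U} x.2 := by
  classical
  have hfin : ∀ x : ℕ × ℕ,
      {g : Fin s → ℕ | Fin.cons (α := fun _ => ℕ) x.1 g ∈ U ∧ ∑ i, g i = x.2}.Finite :=
    fun x => (finite_sum_eq x.2).subset fun g hg => hg.2
  have hfinU : {g : Fin (s + 1) → ℕ | g ∈ U ∧ ∑ i, g i = N}.Finite :=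
    (finite_sum_eq N).subset fun g hg => hg.2
  simp only [hilbertCount, Set.mem_ofPred_eq]
  rw [Set.ncard_eq_toFinset_card _ hfinU]
  simp_rw [fun x : ℕ × ℕ => Set.ncard_eq_toFinset_card _ (hfin x)]
  rw [← Finset.card_sigma]
  refine Finset.card_nbij' (fun g => ⟨(g 0, ∑ i, Fin.tail g i), Fin.tail g⟩)
    (fun y => Fin.cons y.1.1 y.2) ?_ ?_ ?_ ?_
  · intro g hg
    simp only [Set.Finite.coe_toFinset, Set.mem_ofPred_eq] at hg
    simpa [Fin.tail, ← Fin.sum_univ_succ, and_comm] using hg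
  · rintro ⟨⟨t, m⟩, g⟩ hy
    simp only [Finset.coe_sigma, Set.mem_sigma_iff, Finset.mem_coe,
      Finset.HasAntidiagonal.mem_antidiagonal, Set.Finite.mem_toFinset, Set.mem_ofPred_eq] at hy
    obtain ⟨h1, h2, h3⟩ := hy
    simp [Fin.sum_univ_succ, h2, h3, h1]
  · intro g _
    simp
  · rintro ⟨⟨t, m⟩, g⟩ hy
    simp only [Finset.coe_sigma, Set.mem_sigma_iff, Finset.mem_coe,
      Finset.HasAntidiagonal.mem_antidiagonal, Set.Finite.mem_toFinset, Set.mem_ofPred_eq] at hy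
    obtain ⟨h1, h2, h3⟩ := hy
    simp [h3]

/-- An increasing chain of upper sets in a well-quasi-order becomes stationary. -/
theorem upperSet_chain_stationary {α : Type*} [Preorder α] [WellQuasiOrderedLE α]
    (U : ℕ → Set α) (hU : ∀ t, IsUpperSet (U t)) (hmono : Monotone U) :
    ∃ T, ∀ t, T ≤ t → U t = U T := by
  by_contra! hcon
  have hcon' : ∀ T, ∃ t, T ≤ t ∧ ∃ x ∈ U t, x ∉ U T := by
    intro T
    obtain ⟨t, hTt, hne⟩ := hcon T
    refine ⟨t, hTt, ?_⟩
    by_contra! h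
    exact hne (Set.Subset.antisymm h (hmono hTt))
  choose t ht x hx hx' using hcon'
  -- for `a < b`, the set `U (u b)` contains `x (u a)`, but not `x (u b)`
  let u : ℕ → ℕ := fun a => Nat.rec 0 (fun _ v => t v) a
  have hu : Monotone u := monotone_nat_of_le_succ fun a => ht (u a)
  obtain ⟨a, b, hab, hle⟩ := wellQuasiOrdered_le fun a => x (u a)
  exact hx' (u b) (hU _ hle (hmono (hu (Nat.succ_le_of_lt hab)) (hx (u a))))

open PowerSeries in
/-- If `a t` is independent of `t` for `t ≥ T` and every `∑ a t m X ^ m` becomes a polynomial after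
multiplication by `(1 - X) ^ s`, then `∑ a t m X ^ (t + m)` becomes one after multiplication
by `(1 - X) ^ (s + 1)`. -/
theorem antidiagonal_sum_rational (s : ℕ) (T : ℕ) : ∀ a : ℕ → ℕ → ℚ,
    (∀ t, T ≤ t → a t = a T) →
    (∀ t, ∃ p : Polynomial ℚ, PowerSeries.mk (a t) * (1 - X : ℚ⟦X⟧) ^ s = p) →
    ∃ p : Polynomial ℚ, PowerSeries.mk
      (fun N => ∑ x ∈ Finset.HasAntidiagonal.antidiagonal N, a x.1 x.2) *
        (1 - X : ℚ⟦X⟧) ^ (s + 1) = p := by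
  induction T with
  | zero =>
    intro a hT ha
    obtain ⟨p, hp⟩ := ha 0
    refine ⟨p, ?_⟩
    have : PowerSeries.mk (fun N => ∑ x ∈ Finset.HasAntidiagonal.antidiagonal N, a x.1 x.2) =
        PowerSeries.mk 1 * PowerSeries.mk (a 0) := by
      ext N
      simp [PowerSeries.coeff_mul, fun t => hT t (Nat.zero_le t)]
    rw [this, ← hp, pow_succ]
    linear_combination (PowerSeries.mk (a 0) * (1 - X) ^ s) * mk_one_mul_one_sub_eq_one ℚ
  | succ T ih =>
    intro a hT ha
    obtain ⟨p, hp⟩ := ha 0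
    obtain ⟨q, hq⟩ := ih (fun t => a (t + 1)) (fun t ht => hT (t + 1) (by omega))
      (fun t => ha (t + 1))
    refine ⟨p * (1 - Polynomial.X) + Polynomial.X * q, ?_⟩
    have : PowerSeries.mk (fun N => ∑ x ∈ Finset.HasAntidiagonal.antidiagonal N, a x.1 x.2) =
        PowerSeries.mk (a 0) + X * PowerSeries.mk
          (fun N => ∑ x ∈ Finset.HasAntidiagonal.antidiagonal N, a (x.1 + 1) x.2) := by
      ext N
      cases N with
      | zero => simp
      | succ N => simp [Finset.Nat.antidiagonal_succ, PowerSeries.coeff_succ_X_mul]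
    rw [this]
    rw [Polynomial.coe_add, Polynomial.coe_mul, Polynomial.coe_mul, Polynomial.coe_sub,
      Polynomial.coe_one, Polynomial.coe_X, ← hp, ← hq]
    ring

open PowerSeries in
/-- The generating function of the Hilbert function of an upper set in `s` variables is a rational
function with denominator `(1 - X) ^ s`: slice the set along the first coordinate. -/
theorem hilbertCount_rational (s : ℕ) : ∀ U : Set (Fin s → ℕ), IsUpperSet U →
    ∃ p : Polynomial ℚ,
      PowerSeries.mk (fun N => (hilbertCount U N : ℚ)) * (1 - X : ℚ⟦X⟧) ^ s = p := by
  induction s with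
  | zero =>
    intro U _
    refine ⟨Polynomial.C (hilbertCount U 0 : ℚ), ?_⟩
    ext N
    cases N with
    | zero => simp
    | succ N => simp [hilbertCount]
  | succ s ih =>
    intro U hU
    let V : ℕ → Set (Fin s → ℕ) := fun t => {g | Fin.cons t g ∈ U}
    have hV : ∀ t, IsUpperSet (V t) := fun t g g' hle hg =>
      hU (Fin.cons_le_cons.2 ⟨le_rfl, hle⟩) hg
    have hmono : Monotone V := fun t t' hle g hg =>
      hU (Fin.cons_le_cons.2 ⟨hle, le_rfl⟩) hg
    obtain ⟨T, hT⟩ := upperSet_chain_stationary V hV hmono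
    obtain ⟨p, hp⟩ := antidiagonal_sum_rational s T (fun t m => (hilbertCount (V t) m : ℚ))
      (fun t ht => by rw [hT t ht]) (fun t => ih _ (hV t))
    refine ⟨p, ?_⟩
    rw [← hp]
    congr 2
    funext N
    rw [hilbertCount_succ]
    push_cast
    rfl

theorem natDegree_hilbertPoly_le (p : Polynomial ℚ) (s : ℕ) :
    (Polynomial.hilbertPoly p (s + 1)).natDegree ≤ s := by
  rw [Polynomial.hilbertPoly_succ]
  refine Polynomial.natDegree_sum_le_of_forall_le _ _ fun i _ => ?_
  exact (Polynomial.natDegree_smul_le _ _).trans (Polynomial.natDegree_preHilbertPoly ℚ s i).le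

/-- The Hilbert function of an upper set, that is, of a monomial ideal in `s + 1` variables, is
eventually a polynomial of degree at most `s`. -/
theorem hilbertCount_eventually_poly {s : ℕ} (U : Set (Fin (s + 1) → ℕ)) (hU : IsUpperSet U) :
    ∃ p : Polynomial ℚ, p.natDegree ≤ s ∧
      ∀ᶠ N : ℕ in Filter.atTop, p.eval (N : ℚ) = hilbertCount U N := by
  obtain ⟨p, hp⟩ := hilbertCount_rational (s + 1) U hU
  refine ⟨Polynomial.hilbertPoly p (s + 1), natDegree_hilbertPoly_le p s, ?_⟩
  filter_upwards [Filter.eventually_gt_atTop p.natDegree] with N hN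
  rw [← Polynomial.coeff_mul_invOneSubPow_eq_hilbertPoly_eval (s + 1) hN, ← hp,
    ← PowerSeries.invOneSubPow_inv_eq_one_sub_pow, mul_assoc, Units.inv_eq_val_inv,
    Units.inv_mul, mul_one, PowerSeries.coeff_mk]

/-! ### Order embeddings and their gaps -/

/-- The values of an order embedding `f : Fin d ↪o Fin n`, shifted by one and completed by `0` at
the beginning and `n + 1` from the index `d + 1` on. -/
def markers {d n : ℕ} (f : Fin d ↪o Fin n) : ℕ → ℕ
  | 0 => 0
  | j + 1 => if h : j < d then f ⟨j, h⟩ + 1 else n + 1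

theorem markers_lt_succ {d n : ℕ} (f : Fin d ↪o Fin n) {l : ℕ} (hl : l ≤ d) :
    markers f l < markers f (l + 1) := by
  cases l with
  | zero => simp only [markers]; split_ifs <;> omega
  | succ j =>
    have hj : j < d := hl
    simp only [markers, hj, dif_pos]
    split_ifs with h
    · have : f ⟨j, hj⟩ < f ⟨j + 1, h⟩ := f.strictMono (by simp [Fin.lt_def])
      have := Fin.lt_def.1 this
      omega
    · omega

/-- The numbers of points of `Fin n` before, between and after the values of
`f : Fin d ↪o Fin n`. -/
def gaps {d n : ℕ} (f : Fin d ↪o Fin n) (l : Fin (d + 1)) : ℕ :=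
  markers f (l + 1) - markers f l - 1

theorem markers_succ {d n : ℕ} (f : Fin d ↪o Fin n) (l : Fin (d + 1)) :
    markers f (l + 1) = markers f l + gaps f l + 1 := by
  have := markers_lt_succ f (Nat.le_of_lt_succ l.2)
  simp only [gaps]
  omega

/-- If the gaps of `f'` dominate those of `f`, the displacement of the markers is nondecreasing. -/
theorem markers_add_le {d m n : ℕ} {f : Fin d ↪o Fin m} {f' : Fin d ↪o Fin n}
    (h : gaps f ≤ gaps f') {a b : ℕ} (hab : a ≤ b) (hb : b ≤ d + 1) :
    markers f b + markers f' a ≤ markers f' b + markers f a := by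
  induction b, hab using Nat.le_induction with
  | base => omega
  | succ b hab ih =>
    have h1 := markers_succ f ⟨b, hb⟩
    have h2 := markers_succ f' ⟨b, hb⟩
    have h3 : gaps f ⟨b, hb⟩ ≤ gaps f' ⟨b, hb⟩ := h ⟨b, hb⟩
    have := ih (by omega)
    simp only at h1 h2
    omega

/-- An embedding whose gaps are at least those of `f` factors through `f`: move a point `x` to the
right by the largest displacement of a value `f j ≤ x`. -/
theorem exists_trans_eq_of_gaps_le {d m n : ℕ} {f : Fin d ↪o Fin m} {f' : Fin d ↪o Fin n}
    (h : gaps f ≤ gaps f') : ∃ g : Fin m ↪o Fin n, f.trans g = f' := by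
  classical
  have hmk : ∀ {n : ℕ} (f : Fin d ↪o Fin n) (j : Fin d), markers f (j + 1) = f j + 1 := by
    intro n f j; simp [markers]
  have hend : ∀ {n : ℕ} (f : Fin d ↪o Fin n), markers f (d + 1) = n + 1 := by
    intro n f; simp [markers]
  have hle : ∀ j, (f j : ℕ) ≤ f' j := by
    intro j
    have := markers_add_le h (Nat.zero_le ((j : ℕ) + 1)) (by omega)
    rw [hmk, hmk] at this
    simp only [markers] at this
    omega
  have hmono : ∀ {a b : Fin d}, a ≤ b → (f' a : ℕ) - f a ≤ f' b - f b := by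
    intro a b hab
    have := markers_add_le h (Nat.succ_le_succ (Fin.le_def.1 hab)) (by omega)
    rw [Nat.succ_eq_add_one, Nat.succ_eq_add_one, hmk, hmk, hmk, hmk] at this
    have := hle a
    have := hle b
    omega
  have hmn : m ≤ n := by
    have := markers_add_le h (Nat.zero_le (d + 1)) le_rfl
    rw [hend, hend] at this
    simp only [markers] at this
    omega
  have hbound : ∀ j, (f' j : ℕ) - f j ≤ n - m := by
    intro j
    have := markers_add_le h (show (j : ℕ) + 1 ≤ d + 1 by omega) le_rfl
    rw [hmk, hmk, hend, hend] at this
    have := hle j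
    omega
  let δ : Fin m → ℕ := fun x =>
    (Finset.univ.filter fun j => f j ≤ x).sup fun j => (f' j : ℕ) - f j
  have hδ : Monotone δ := fun x y hxy =>
    Finset.sup_mono fun j hj => by
      simp only [Finset.mem_filter, Finset.mem_univ, true_and] at hj ⊢
      exact hj.trans hxy
  have hδb : ∀ x, δ x ≤ n - m := fun x => Finset.sup_le fun j _ => hbound j
  refine ⟨OrderEmbedding.ofStrictMono (fun x => ⟨x + δ x, by have := hδb x; omega⟩) ?_, ?_⟩
  · intro x y hxy
    have h1 := hδ hxy.le
    have h2 := Fin.lt_def.1 hxy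
    simp only [Fin.lt_def]
    omega
  · ext j
    have : δ (f j) = f' j - f j := by
      refine le_antisymm (Finset.sup_le fun i hi => ?_) (Finset.le_sup (f := fun j =>
        (f' j : ℕ) - f j) (by simp))
      simp only [Finset.mem_filter, Finset.mem_univ, true_and, f.le_iff_le] at hi
      exact hmono hi
    have hj := hle j
    change (f j : ℕ) + δ (f j) = f' j
    omega

theorem gaps_injective {d n : ℕ} :
    Function.Injective (gaps : (Fin d ↪o Fin n) → Fin (d + 1) → ℕ) := by
  intro f f' h
  ext j
  have h1 := markers_add_le h.le (Nat.zero_le ((j : ℕ) + 1)) (by omega)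
  have h2 := markers_add_le h.ge (Nat.zero_le ((j : ℕ) + 1)) (by omega)
  have hj : (⟨j, j.2⟩ : Fin d) = j := rfl
  simp only [markers, j.2, dif_pos, hj] at h1 h2
  omega

theorem markers_eq_sum {d n : ℕ} (f : Fin d ↪o Fin n) {l : ℕ} (hl : l ≤ d + 1) :
    markers f l = l + ∑ i : Fin (d + 1) with i.val < l, gaps f i := by
  induction l with
  | zero => simp [markers]
  | succ l ih =>
    have h1 := markers_succ f ⟨l, hl⟩
    have h2 : (Finset.univ.filter fun i : Fin (d + 1) => i.val < l + 1) =
        insert ⟨l, hl⟩ (Finset.univ.filter fun i : Fin (d + 1) => i.val < l) := by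
      ext i
      simp [Fin.ext_iff]
      omega
    rw [h2, Finset.sum_insert (by simp)]
    have := ih (by omega)
    simp only at h1
    omega

theorem sum_gaps {d n : ℕ} (f : Fin d ↪o Fin n) : ∑ i, gaps f i + d = n := by
  have := markers_eq_sum f le_rfl
  simp only [markers, lt_irrefl, dif_neg, not_false_iff, Fin.is_lt, Finset.filter_true] at this
  omega

/-- Every vector with coordinate sum `n - d` is a gap vector: the `j`-th value of the embedding is
`j` plus the sum of the gaps up to the `j`-th. -/
theorem exists_gaps_eq {d n : ℕ} (g : Fin (d + 1) → ℕ) (hg : ∑ i, g i + d = n) :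
    ∃ f : Fin d ↪o Fin n, gaps f = g := by
  let S : ℕ → ℕ := fun l => ∑ i : Fin (d + 1) with i.val < l, g i
  have hS : Monotone S := fun a b hab => Finset.sum_le_sum_of_subset fun i hi => by
    simp only [Finset.mem_filter, Finset.mem_univ, true_and] at hi ⊢
    omega
  have hSl : ∀ l : Fin (d + 1), S (l + 1) = S l + g l := by
    intro l
    have h2 : (Finset.univ.filter fun i : Fin (d + 1) => i.val < l + 1) =
        insert l (Finset.univ.filter fun i : Fin (d + 1) => i.val < l) := by
      ext i
      simp [Fin.ext_iff]
      omega
    simp only [S]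
    rw [h2, Finset.sum_insert (by simp), add_comm]
  have hend : S (d + 1) = ∑ i, g i := by
    simp only [S, Fin.is_lt, Finset.filter_true]
  have h0 : S 0 = 0 := by simp [S]
  let f : Fin d ↪o Fin n := OrderEmbedding.ofStrictMono
    (fun j => ⟨j + S (j + 1), by have := hS (show (j : ℕ) + 1 ≤ d + 1 by omega); omega⟩) (by
      intro a b hab
      have := hS (show (a : ℕ) + 1 ≤ b + 1 by have := Fin.lt_def.1 hab; omega)
      simp only [Fin.lt_def] at hab ⊢
      omega)
  have hf : ∀ l, l ≤ d + 1 → markers f l = l + S l := by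
    intro l hl
    cases l with
    | zero => simp [markers, h0]
    | succ j =>
      by_cases hj : j < d
      · have : (f ⟨j, hj⟩ : ℕ) = j + S (j + 1) := rfl
        simp only [markers, hj, dif_pos, this]
        omega
      · obtain rfl : j = d := by omega
        simp [markers]; omega
  refine ⟨f, funext fun l => ?_⟩
  rw [gaps, hf _ (by omega), hf _ (by omega), hSl]
  omega

/-- The size of a family of sets of order embeddings `Fin d ↪o Fin n` that is closed under
composition with order embeddings is eventually a polynomial in `n`, since the gap vectors form an
upper set. -/
theorem ncard_embeddings_eventually_poly {d : ℕ} (V : ∀ n, Set (Fin d ↪o Fin n))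
    (hV : ∀ {m n : ℕ} (h : Fin m ↪o Fin n), ∀ f ∈ V m, f.trans h ∈ V n) :
    ∃ p : Polynomial ℚ, p.natDegree ≤ d ∧
      ∀ᶠ n : ℕ in Filter.atTop, p.eval (n : ℚ) = (V n).ncard := by
  let U : Set (Fin (d + 1) → ℕ) := {g | ∃ n, ∃ f ∈ V n, gaps f = g}
  have hU : IsUpperSet U := by
    rintro _ g' hle ⟨n, f, hf, rfl⟩
    obtain ⟨f', hf'⟩ := exists_gaps_eq g' rfl
    rw [← hf'] at hle ⊢
    obtain ⟨h, rfl⟩ := exists_trans_eq_of_gaps_le hle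
    exact ⟨_, _, hV h f hf, rfl⟩
  have hcount : ∀ N, (V (N + d)).ncard = hilbertCount U N := by
    intro N
    rw [hilbertCount, ← Set.ncard_image_of_injective _ gaps_injective]
    congr 1
    ext g
    constructor
    · rintro ⟨f, hf, rfl⟩
      exact ⟨⟨_, f, hf, rfl⟩, by have := sum_gaps f; omega⟩
    · rintro ⟨⟨n, f, hf, rfl⟩, hN⟩
      obtain rfl : N + d = n := by have := sum_gaps f; omega
      exact ⟨f, hf, rfl⟩
  obtain ⟨p, hp, hev⟩ := hilbertCount_eventually_poly U hU
  refine ⟨p.comp (Polynomial.X - Polynomial.C (d : ℚ)), ?_, ?_⟩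
  · rwa [Polynomial.natDegree_comp, Polynomial.natDegree_X_sub_C, mul_one]
  · obtain ⟨N₀, hN₀⟩ := Filter.eventually_atTop.1 hev
    filter_upwards [Filter.eventually_ge_atTop (N₀ + d)] with n hn
    obtain ⟨N, rfl⟩ : ∃ N, n = N + d := ⟨n - d, by omega⟩
    rw [hcount, ← hN₀ N (by omega)]
    simp

/-! ### Finitely generated free `OI`-sets -/

/-- A finitely generated free `OI`-set: finite sets `obj n` on which the order embeddings
`Fin m ↪o Fin n` act, together with an identification with a finite disjoint union of representable
functors `Fin (arity p) ↪o Fin n`. -/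
structure FreeOISet where
  /-- the underlying sets -/
  obj : ℕ → Type
  /-- the action of order embeddings -/
  map : ∀ {m n : ℕ}, (Fin m ↪o Fin n) → obj m → obj n
  /-- the index set of the generators -/
  Gen : Type
  [finite_gen : Finite Gen]
  /-- the generator `p` lies in `obj (arity p)` -/
  arity : Gen → ℕ
  /-- every element is the image of a unique generator under a unique order embedding -/
  decomp : ∀ n, obj n ≃ Σ p : Gen, (Fin (arity p) ↪o Fin n)
  decomp_map : ∀ {m n : ℕ} (h : Fin m ↪o Fin n) (x : obj m),
    decomp n (map h x) = ⟨(decomp m x).1, (decomp m x).2.trans h⟩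

namespace FreeOISet

attribute [instance] FreeOISet.finite_gen

variable (X : FreeOISet)

instance finite_obj (n : ℕ) : Finite (X.obj n) := Finite.of_equiv _ (X.decomp n).symm

/-- The image of the generator `p` under the order embedding `f`. -/
def elt (p : X.Gen) {n : ℕ} (f : Fin (X.arity p) ↪o Fin n) : X.obj n :=
  (X.decomp n).symm ⟨p, f⟩

theorem exists_eq_elt {n : ℕ} (x : X.obj n) : ∃ p f, x = X.elt p f :=
  ⟨(X.decomp n x).1, (X.decomp n x).2, ((X.decomp n).symm_apply_apply x).symm⟩

theorem decomp_elt (p : X.Gen) {n : ℕ} (f : Fin (X.arity p) ↪o Fin n) :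
    X.decomp n (X.elt p f) = ⟨p, f⟩ :=
  (X.decomp n).apply_symm_apply _

theorem map_elt {m n : ℕ} (h : Fin m ↪o Fin n) (p : X.Gen) (f : Fin (X.arity p) ↪o Fin m) :
    X.map h (X.elt p f) = X.elt p (f.trans h) := by
  apply (X.decomp n).injective
  rw [decomp_map, decomp_elt, decomp_elt]

theorem map_trans {l m n : ℕ} (g : Fin l ↪o Fin m) (h : Fin m ↪o Fin n) (x : X.obj l) :
    X.map (g.trans h) x = X.map h (X.map g x) := by
  obtain ⟨p, f, rfl⟩ := X.exists_eq_elt x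
  simp only [map_elt]
  rfl

theorem map_refl {n : ℕ} (x : X.obj n) : X.map (RelEmbedding.refl _) x = x := by
  obtain ⟨p, f, rfl⟩ := X.exists_eq_elt x
  rw [map_elt]
  rfl

/-- Elements are compared by their generator and then by the image of their embedding, in the
colexicographic order. -/
noncomputable def sortKey {n : ℕ} (x : X.obj n) :
    Fin (Nat.card X.Gen) ×ₗ Colex (Finset (Fin n)) :=
  toLex (Finite.equivFin X.Gen (X.decomp n x).1,
    toColex (Finset.univ.map (X.decomp n x).2.toEmbedding))

theorem sortKey_elt (p : X.Gen) {n : ℕ} (f : Fin (X.arity p) ↪o Fin n) :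
    X.sortKey (X.elt p f) =
      toLex (Finite.equivFin X.Gen p, toColex (Finset.univ.map f.toEmbedding)) := by
  rw [sortKey, decomp_elt]

theorem sortKey_injective {n : ℕ} : Function.Injective (X.sortKey (n := n)) := by
  intro x y hxy
  obtain ⟨p, f, rfl⟩ := X.exists_eq_elt x
  obtain ⟨q, g, rfl⟩ := X.exists_eq_elt y
  rw [sortKey_elt, sortKey_elt, toLex_inj, Prod.mk.injEq, EmbeddingLike.apply_eq_iff_eq,
    toColex_inj] at hxy
  obtain ⟨rfl, h⟩ := hxy
  have : Set.range f = Set.range g := by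
    simpa using congrArg (fun S : Finset (Fin n) => (S : Set (Fin n))) h
  rw [OrderEmbedding.range_inj.1 this]

/-- The order on basis elements with respect to which leading terms are taken. It is chosen such
that order embeddings act by strictly monotone maps. -/
noncomputable instance linearOrderObj (n : ℕ) : LinearOrder (X.obj n) :=
  LinearOrder.lift' X.sortKey X.sortKey_injective

theorem strictMono_map {m n : ℕ} (h : Fin m ↪o Fin n) : StrictMono (X.map h) := by
  intro x y hxy
  change X.sortKey x < X.sortKey y at hxy
  change X.sortKey (X.map h x) < X.sortKey (X.map h y)
  obtain ⟨p, f, rfl⟩ := X.exists_eq_elt x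
  obtain ⟨q, g, rfl⟩ := X.exists_eq_elt y
  simp only [map_elt, sortKey_elt, Prod.Lex.lt_iff, ofLex_toLex] at hxy ⊢
  refine hxy.imp id fun ⟨h1, h2⟩ => ⟨h1, ?_⟩
  have key : ∀ {d : ℕ} (f : Fin d ↪o Fin m), Finset.univ.map (f.trans h).toEmbedding =
      (Finset.univ.map f.toEmbedding).image h := by
    intro d f; ext; simp
  rw [key, key]
  exact (Finset.Colex.toColex_image_lt_toColex_image h.strictMono).2 h2

/-- `x` divides `y` if `y` is the image of `x` under some order embedding. -/
def Divides (x y : Σ n, X.obj n) : Prop := ∃ h : Fin x.1 ↪o Fin y.1, X.map h x.2 = y.2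

instance isPreorder_divides : IsPreorder (Σ n, X.obj n) X.Divides where
  refl x := ⟨_, X.map_refl x.2⟩
  trans := by
    rintro x y z ⟨g, hg⟩ ⟨h, hh⟩
    exact ⟨g.trans h, by rw [map_trans, hg, hh]⟩

theorem divides_of_gaps_le {x y : Σ n, X.obj n} {p : X.Gen} {f : Fin (X.arity p) ↪o Fin x.1}
    {g : Fin (X.arity p) ↪o Fin y.1} (hx : x.2 = X.elt p f) (hy : y.2 = X.elt p g)
    (h : gaps f ≤ gaps g) : X.Divides x y := by
  obtain ⟨e, rfl⟩ := exists_trans_eq_of_gaps_le h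
  exact ⟨e, by rw [hx, hy, map_elt]⟩

/-- Divisibility is a well-quasi-order: by Dickson's lemma for the gap vectors. -/
theorem wellQuasiOrdered_divides : WellQuasiOrdered X.Divides := by
  classical
  intro u
  choose p f hf using fun a => X.exists_eq_elt (u a).2
  -- all gap vectors are put into one product, in the factor of their generator
  let key : ℕ → X.Gen × ((q : X.Gen) → Fin (X.arity q + 1) → ℕ) := fun a =>
    (p a, Function.update 0 (p a) (gaps (f a)))
  obtain ⟨a, b, hab, h1, h2⟩ := (Finite.wellQuasiOrdered (Eq : X.Gen → X.Gen → Prop)).prod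
    (wellQuasiOrdered_le (α := (p : X.Gen) → Fin (X.arity p + 1) → ℕ)) key
  refine ⟨a, b, hab, ?_⟩
  have hle := h2 (p a)
  have hb := hf b
  simp only [key, Function.update_self] at h1 hle
  generalize f b = g at hb hle
  revert g
  rw [← h1]
  intro g hb hle
  rw [Function.update_self] at hle
  exact X.divides_of_gaps_le (hf a) hb hle

/-- The size of a family of subsets that is closed under the action of order embeddings is
eventually a polynomial in `n`. -/
theorem ncard_eventually_poly {D : ℕ} (hD : ∀ p, X.arity p ≤ D) (U : ∀ n, Set (X.obj n))
    (hU : ∀ {m n : ℕ} (h : Fin m ↪o Fin n), ∀ x ∈ U m, X.map h x ∈ U n) :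
    ∃ p : Polynomial ℚ, p.natDegree ≤ D ∧
      ∀ᶠ n : ℕ in Filter.atTop, p.eval (n : ℚ) = (U n).ncard := by
  have : Fintype X.Gen := Fintype.ofFinite _
  choose P hdeg hP using fun p : X.Gen =>
    ncard_embeddings_eventually_poly (fun n => {f : Fin (X.arity p) ↪o Fin n | X.elt p f ∈ U n})
      (fun h f hf => by
        rw [Set.mem_ofPred_eq, ← map_elt]
        exact hU h _ hf)
  refine ⟨∑ p, P p, Polynomial.natDegree_sum_le_of_forall_le _ _ fun p _ =>
    (hdeg p).trans (hD p), ?_⟩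
  filter_upwards [Filter.eventually_all.2 hP] with n hn
  let e : (Σ p : X.Gen, {f : Fin (X.arity p) ↪o Fin n | X.elt p f ∈ U n}) → U n :=
    fun y => ⟨X.elt y.1 y.2.1, y.2.2⟩
  have he : Function.Bijective e := by
    constructor
    · rintro ⟨p, f, hf⟩ ⟨q, g, hg⟩ h
      have h' := congrArg (X.decomp n) (congrArg Subtype.val h)
      simp only [e, decomp_elt] at h'
      cases h'
      rfl
    · rintro ⟨x, hx⟩
      obtain ⟨p, f, rfl⟩ := X.exists_eq_elt x
      exact ⟨⟨p, f, hx⟩, rfl⟩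
  rw [← Nat.card_coe_set_eq, ← Nat.card_congr (Equiv.ofBijective e he), Nat.card_sigma,
    Polynomial.eval_finsetSum]
  push_cast
  exact Finset.sum_congr rfl fun p _ => hn p

end FreeOISet

/-- An order embedding factors through every intermediate cardinality. -/
theorem exists_trans_eq {a b c : ℕ} (h : Fin a ↪o Fin c) (hab : a ≤ b) (hbc : b ≤ c) :
    ∃ (g : Fin a ↪o Fin b) (g' : Fin b ↪o Fin c), g.trans g' = h := by
  obtain ⟨S, hS, -, hcard⟩ := Finset.exists_subsuperset_card_eq
    (Finset.subset_univ (Finset.univ.map h.toEmbedding)) (by simpa using hab) (by simpa using hbc)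
  let g' := S.orderEmbOfFin hcard
  have hr : ∀ x, ∃ y, g' y = h x := by
    intro x
    have : h x ∈ Set.range g' := by
      rw [Finset.range_orderEmbOfFin]
      exact hS (by simp)
    exact this
  choose g hg using hr
  refine ⟨OrderEmbedding.ofMapLEIff g fun x y => ?_, g', ?_⟩
  · rw [← g'.le_iff_le, hg, hg, h.le_iff_le]
  · ext x
    simp [hg]

/-! ### Leading ideals -/

section Leading
variable {k : Type*} [CommRing k] {ι : Type*} [LinearOrder ι]

/-- The ideal of the coefficients at `b` of the elements of `W` that involve no basis element larger
than `b`. -/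
noncomputable def leadIdeal (W : Submodule k (ι →₀ k)) (b : ι) : Ideal k :=
  (W ⊓ Finsupp.supported k k (Set.Iic b)).map (Finsupp.lapply b)

theorem mem_leadIdeal {W : Submodule k (ι →₀ k)} {b : ι} {c : k} :
    c ∈ leadIdeal W b ↔ ∃ w ∈ W, (∀ b', b < b' → w b' = 0) ∧ w b = c := by
  simp only [leadIdeal, Submodule.mem_map, Submodule.mem_inf, Finsupp.mem_supported',
    Set.mem_Iic, not_le, Finsupp.lapply_apply, and_assoc]

/-- A strictly monotone map of bases carries leading terms to leading terms. -/
theorem leadIdeal_le_of_mapDomain {κ : Type*} [LinearOrder κ] {f : ι → κ} (hf : StrictMono f)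
    {W : Submodule k (ι →₀ k)} {V : Submodule k (κ →₀ k)}
    (h : ∀ w ∈ W, Finsupp.mapDomain f w ∈ V) (b : ι) : leadIdeal W b ≤ leadIdeal V (f b) := by
  intro c hc
  obtain ⟨w, hw, hlt, rfl⟩ := mem_leadIdeal.1 hc
  refine mem_leadIdeal.2 ⟨_, h w hw, fun b' hb' => ?_, Finsupp.mapDomain_apply hf.injective _ _⟩
  by_cases hr : b' ∈ Set.range f
  · obtain ⟨b'', rfl⟩ := hr
    rw [Finsupp.mapDomain_apply hf.injective]
    exact hlt _ (hf.lt_iff_lt.1 hb')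
  · exact Finsupp.mapDomain_of_notMem_range _ _ hr

/-- Nested submodules with the same leading ideals are equal: the division algorithm. -/
theorem le_of_leadIdeal_le [Finite ι] {V W : Submodule k (ι →₀ k)} (hVW : V ≤ W)
    (h : ∀ b, leadIdeal W b ≤ leadIdeal V b) : W ≤ V := by
  have key : ∀ b, ∀ w ∈ W, (∀ b', b < b' → w b' = 0) → w ∈ V := by
    intro b
    induction b using WellFoundedLT.induction with
    | ind b ih =>
      intro w hw hb
      obtain ⟨v, hv, hvb, hc⟩ := mem_leadIdeal.1 (h b (mem_leadIdeal.2 ⟨w, hw, hb, rfl⟩))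
      suffices w - v ∈ V by simpa using V.add_mem this hv
      by_cases h0 : w - v = 0
      · rw [h0]; exact V.zero_mem
      have hne := Finsupp.support_nonempty_iff.2 h0
      refine ih ((w - v).support.max' hne) ?_ _ (W.sub_mem hw (hVW hv)) ?_
      · have hmem := Finsupp.mem_support_iff.1 ((w - v).support.max'_mem hne)
        by_contra! hle
        rcases hle.eq_or_lt with heq | hlt
        · rw [← heq] at hmem; simp [hc] at hmem
        · simp [hb _ hlt, hvb _ hlt] at hmem
      · intro b' hb'
        by_contra hne'
        exact hb'.not_ge (Finset.le_max' _ _ (Finsupp.mem_support_iff.2 hne'))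
  intro w hw
  by_cases h0 : w = 0
  · rw [h0]; exact V.zero_mem
  have hne := Finsupp.support_nonempty_iff.2 h0
  refine key (w.support.max' hne) w hw fun b' hb' => ?_
  by_contra hne'
  exact hb'.not_ge (Finset.le_max' _ _ (Finsupp.mem_support_iff.2 hne'))

/-- Over a field, the dimension of a subspace is the number of its leading basis elements: a vector
of the subspace is determined by its coordinates at these elements, which may be prescribed. -/
theorem finrank_eq_ncard_leadIdeal {K : Type*} [Field K] [Finite ι] (W : Submodule K (ι →₀ K)) :
    Module.finrank K W = {b | leadIdeal W b ≠ ⊥}.ncard := by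
  classical
  set S := {b | leadIdeal W b ≠ ⊥} with hS
  let φ : W →ₗ[K] (S →₀ K) := (Finsupp.lcomapDomain (Subtype.val : S → ι)
    Subtype.val_injective) ∘ₗ W.subtype
  have hφ : ∀ (w : W) (b : S), φ w b = (w : ι →₀ K) b := fun w b => rfl
  have hinj : Function.Injective φ := by
    rw [injective_iff_map_eq_zero]
    rintro ⟨w, hw⟩ h0
    by_contra hne
    have hw0 : w ≠ 0 := fun h => hne (Subtype.ext h)
    have hne := Finsupp.support_nonempty_iff.2 hw0
    set b := w.support.max' hne
    have hwb : w b ≠ 0 := Finsupp.mem_support_iff.1 (w.support.max'_mem hne)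
    have hb : b ∈ S := by
      intro hbot
      have : w b ∈ leadIdeal W b := mem_leadIdeal.2 ⟨w, hw, fun b' hb' => by
        by_contra hne'
        exact hb'.not_ge (Finset.le_max' _ _ (Finsupp.mem_support_iff.2 hne')), rfl⟩
      rw [hbot] at this
      exact hwb ((Submodule.mem_bot K).1 this)
    exact hwb (by rw [← hφ ⟨w, hw⟩ ⟨b, hb⟩, h0]; rfl)
  have hsingle : ∀ b : S, Finsupp.single b (1 : K) ∈ LinearMap.range φ := by
    intro b
    induction b using WellFoundedLT.induction with
    | ind b ih =>
      have hbot : leadIdeal W (b : ι) ≠ ⊥ := b.2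
      obtain ⟨c, hc, hc0⟩ := (Submodule.ne_bot_iff _).1 hbot
      obtain ⟨w, hw, hlt, rfl⟩ := mem_leadIdeal.1 hc
      have h1 : φ ⟨w, hw⟩ ∈ LinearMap.range φ := ⟨_, rfl⟩
      have h2 : φ ⟨w, hw⟩ = Finsupp.single b (w b) + (φ ⟨w, hw⟩).erase b := by
        rw [← hφ ⟨w, hw⟩ b, Finsupp.single_add_erase]
      have h3 : (φ ⟨w, hw⟩).erase b ∈ LinearMap.range φ := by
        rw [← Finsupp.sum_single ((φ ⟨w, hw⟩).erase b)]
        refine Submodule.sum_mem _ fun b' hb' => ?_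
        rw [← mul_one ((φ ⟨w, hw⟩).erase b b'), ← smul_eq_mul, ← Finsupp.smul_single]
        refine Submodule.smul_mem _ _ (ih b' ?_)
        rw [Finsupp.support_erase, Finset.mem_erase, Finsupp.mem_support_iff] at hb'
        by_contra hle
        exact hb'.2 (hlt b' (lt_of_le_of_ne (not_lt.1 hle) fun h => hb'.1 (Subtype.ext h.symm)))
      have h4 : Finsupp.single b (w b) ∈ LinearMap.range φ := by
        rw [h2] at h1
        exact (Submodule.add_mem_iff_left _ h3).1 h1
      have := Submodule.smul_mem _ (w b)⁻¹ h4
      rwa [Finsupp.smul_single, smul_eq_mul, inv_mul_cancel₀ hc0] at this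
  have hsurj : Function.Surjective φ := by
    intro v
    change v ∈ LinearMap.range φ
    rw [← Finsupp.sum_single v]
    refine Submodule.sum_mem _ fun b _ => ?_
    rw [← mul_one (v b), ← smul_eq_mul, ← Finsupp.smul_single]
    exact Submodule.smul_mem _ _ (hsingle b)
  have : Fintype S := Fintype.ofFinite S
  rw [(LinearEquiv.ofBijective φ ⟨hinj, hsurj⟩).finrank_eq, Module.finrank_finsupp_self,
    ← Nat.card_coe_set_eq, Nat.card_eq_fintype_card]

end Leading

/-! ### Submodules of free `OI`-modules: Noetherianity and Hilbert polynomials -/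

section OISubmodules
variable {k : Type*} [CommRing k] (X : FreeOISet)

/-- A family of submodules of the free modules on the sets `X.obj n` that is closed under the
action of order embeddings, that is, a submodule of the free `OI`-module on `X`. -/
def IsOISubmodule (W : ∀ n, Submodule k (X.obj n →₀ k)) : Prop :=
  ∀ ⦃m n : ℕ⦄ (h : Fin m ↪o Fin n), ∀ w ∈ W m, Finsupp.mapDomain (X.map h) w ∈ W n

variable {X}

theorem leadIdeal_le_map {W : ∀ n, Submodule k (X.obj n →₀ k)} (hW : IsOISubmodule X W) {m n : ℕ}
    (h : Fin m ↪o Fin n) (b : X.obj m) : leadIdeal (W m) b ≤ leadIdeal (W n) (X.map h b) :=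
  leadIdeal_le_of_mapDomain (X.strictMono_map h) (hW h) b

/-- Every leading ideal comes from a bounded degree. Otherwise there would be a sequence of basis
elements none of which inherits its leading ideal from an earlier one; along a subsequence each
divides the next, and the leading ideals form an ascending chain, which is stationary. -/
theorem exists_leadIdeal_bound [IsNoetherianRing k] {W : ∀ n, Submodule k (X.obj n →₀ k)}
    (hW : IsOISubmodule X W) : ∃ N, ∀ y : Σ n, X.obj n, ∃ x : Σ n, X.obj n, x.1 ≤ N ∧
      X.Divides x y ∧ leadIdeal (W y.1) y.2 = leadIdeal (W x.1) x.2 := by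
  by_contra! hcon
  choose y hy using hcon
  -- `y (u b)` inherits its leading ideal from no `y (u a)` with `a < b`
  let u : ℕ → ℕ := fun a => Nat.rec 0 (fun _ v => max v (y v).1) a
  have hu : Monotone u := monotone_nat_of_le_succ fun a => le_max_left _ _
  have hyu : ∀ {a b}, a < b → (y (u a)).1 ≤ u b := fun {a b} hab =>
    (le_max_right (u a) (y (u a)).1).trans (hu (Nat.succ_le_of_lt hab))
  obtain ⟨g, hg⟩ := X.wellQuasiOrdered_divides.exists_monotone_subseq (fun a => y (u a))
  let L : ℕ →o Ideal k := ⟨fun a => leadIdeal (W (y (u (g a))).1) (y (u (g a))).2, fun a b hab => by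
    obtain ⟨h, hh⟩ := hg a b hab
    have := leadIdeal_le_map hW h (y (u (g a))).2
    rwa [hh] at this⟩
  obtain ⟨a, ha⟩ := monotone_stabilizes_iff_noetherian.2 ‹IsNoetherianRing k› L
  exact hy _ _ (hyu (g.strictMono (Nat.lt_succ_self a))) (hg a (a + 1) (Nat.le_succ a))
    (ha (a + 1) (Nat.le_succ a)).symm

/-- Submodules of finitely generated free `OI`-modules over a Noetherian ring are generated in
bounded degree. -/
theorem exists_generation_bound [IsNoetherianRing k] {W : ∀ n, Submodule k (X.obj n →₀ k)}
    (hW : IsOISubmodule X W) : ∃ N, ∀ m, N ≤ m → ∀ n, m ≤ n →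
      W n ≤ ⨆ h : Fin m ↪o Fin n, (W m).map (Finsupp.lmapDomain k k (X.map h)) := by
  obtain ⟨N, hN⟩ := exists_leadIdeal_bound hW
  refine ⟨N, fun m hm n hn => le_of_leadIdeal_le (iSup_le fun h => ?_) fun b => ?_⟩
  · rintro _ ⟨w, hw, rfl⟩
    exact hW h w hw
  · obtain ⟨⟨l, x⟩, hl, ⟨h, hx⟩, hL⟩ := hN ⟨n, b⟩
    change Fin l ↪o Fin n at h
    change X.map h x = b at hx
    change leadIdeal (W n) b = leadIdeal (W l) x at hL
    subst hx
    obtain ⟨g, g', rfl⟩ := exists_trans_eq h (hl.trans hm) hn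
    rw [hL, X.map_trans]
    exact (leadIdeal_le_map hW g x).trans (leadIdeal_le_of_mapDomain (X.strictMono_map g')
      (fun w hw => Submodule.mem_iSup_of_mem
        (p := fun h => (W m).map (Finsupp.lmapDomain k k (X.map h))) g' ⟨w, hw, rfl⟩) _)

/-- The dimensions of a submodule of a free `OI`-module are eventually polynomial, since they count
the leading basis elements, which are closed under the action of order embeddings. -/
theorem finrank_eventually_poly {K : Type*} [Field K] {D : ℕ} (hD : ∀ p, X.arity p ≤ D)
    {W : ∀ n, Submodule K (X.obj n →₀ K)} (hW : IsOISubmodule X W) :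
    ∃ p : Polynomial ℚ, p.natDegree ≤ D ∧
      ∀ᶠ n : ℕ in Filter.atTop, p.eval (n : ℚ) = Module.finrank K (W n) := by
  obtain ⟨p, hp, hev⟩ := X.ncard_eventually_poly hD (fun n => {b | leadIdeal (W n) b ≠ ⊥})
    fun h b hb hbot => hb (le_bot_iff.1 (hbot ▸ leadIdeal_le_map hW h b))
  refine ⟨p, hp, hev.mono fun n hn => ?_⟩
  rw [hn, finrank_eq_ncard_leadIdeal]

/-- The scalars that multiply `Z` into `B`; for `B ≤ Z` this is the annihilator of `Z / B`. -/
def colonIdeal {M : Type*} [AddCommGroup M] [Module k M] (Z B : Submodule k M) : Ideal k :=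
  B.colon (Z : Set M)

theorem mem_colonIdeal {M : Type*} [AddCommGroup M] [Module k M] {Z B : Submodule k M} {r : k} :
    r ∈ colonIdeal Z B ↔ ∀ z ∈ Z, r • z ∈ B :=
  Submodule.mem_colon

/-- From the degree on in which `Z` is generated, the annihilators of the modules `Z n / B n` form
an ascending chain of ideals. -/
theorem colonIdeal_eventually_const [IsNoetherianRing k] {Z B : ∀ n, Submodule k (X.obj n →₀ k)}
    (hZ : IsOISubmodule X Z) (hB : IsOISubmodule X B) :
    ∃ I : Ideal k, ∀ᶠ n : ℕ in Filter.atTop, colonIdeal (Z n) (B n) = I := by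
  obtain ⟨N, hN⟩ := exists_generation_bound hZ
  let L : ℕ →o Ideal k := ⟨fun a => colonIdeal (Z (N + a)) (B (N + a)), fun a b hab r hr => by
    rw [mem_colonIdeal] at hr ⊢
    suffices Z (N + b) ≤ (B (N + b)).comap (LinearMap.lsmul k _ r) from fun z hz => this hz
    refine (hN (N + a) (by omega) (N + b) (by omega)).trans (iSup_le fun h => ?_)
    rintro _ ⟨z, hz, rfl⟩
    have := hB h _ (hr z hz)
    rwa [Finsupp.mapDomain_smul] at this⟩
  obtain ⟨a, ha⟩ := monotone_stabilizes_iff_noetherian.2 ‹IsNoetherianRing k› L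
  refine ⟨L a, ?_⟩
  filter_upwards [Filter.eventually_ge_atTop (N + a)] with n hn
  obtain ⟨b, rfl⟩ : ∃ b, n = N + b := ⟨n - N, by omega⟩
  exact (ha b (by omega)).symm

theorem annihilator_subQuotient {M : Type*} [AddCommGroup M] [Module k M] {Z B : Submodule k M}
    {r : k} : (∀ x : SubQuotient Z B, r • x = 0) ↔ r ∈ colonIdeal Z B := by
  rw [mem_colonIdeal, (Submodule.mkQ_surjective (B.submoduleOf Z)).forall, Subtype.forall]
  refine forall₂_congr fun z hz => ?_
  rw [← map_smul, Submodule.mkQ_apply, Submodule.Quotient.mk_eq_zero]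
  rfl

/-- The exponent of an abelian group is determined by its annihilator in `ℤ`. -/
theorem exponent_eq_of_annihilator {M M' : Type*} [AddCommGroup M] [AddCommGroup M']
    (h : ∀ r : ℤ, (∀ x : M, r • x = 0) ↔ ∀ x : M', r • x = 0) :
    AddMonoid.exponent M = AddMonoid.exponent M' := by
  refine Nat.dvd_antisymm ?_ ?_
  · refine AddMonoid.exponent_dvd_of_forall_nsmul_eq_zero fun x => ?_
    rw [← natCast_zsmul]
    exact (h _).2 (fun y => by rw [natCast_zsmul]; exact AddMonoid.exponent_nsmul_eq_zero y) x
  · refine AddMonoid.exponent_dvd_of_forall_nsmul_eq_zero fun x => ?_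
    rw [← natCast_zsmul]
    exact (h _).1 (fun y => by rw [natCast_zsmul]; exact AddMonoid.exponent_nsmul_eq_zero y) x

end OISubmodules

/-! ### Subquotients and their torsion -/

section SubQuotient
variable {k : Type*} [CommRing k] {M N : Type*} [AddCommGroup M] [Module k M] [AddCommGroup N]
  [Module k N]

/-- Subquotients of a quotient module are subquotients of the module. -/
noncomputable def subQuotientComapEquiv (f : M →ₗ[k] N) (hf : Function.Surjective f)
    (Z B : Submodule k N) : SubQuotient (Z.comap f) (B.comap f) ≃ₗ[k] SubQuotient Z B :=
  let g : Z.comap f →ₗ[k] SubQuotient Z B :=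
    (B.submoduleOf Z).mkQ ∘ₗ f.restrict (p := Z.comap f) (q := Z) fun _ hx => hx
  have hg : Function.Surjective g := by
    refine (Submodule.mkQ_surjective _).comp ?_
    rintro ⟨z, hz⟩
    obtain ⟨x, rfl⟩ := hf z
    exact ⟨⟨x, hz⟩, rfl⟩
  have hker : (B.comap f).submoduleOf (Z.comap f) = LinearMap.ker g := by
    ext x
    rw [LinearMap.mem_ker, LinearMap.comp_apply, Submodule.mkQ_apply,
      Submodule.Quotient.mk_eq_zero]
    rfl
  (Submodule.quotEquivOfEq _ _ hker).trans (g.quotKerEquivOfSurjective hg)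

/-- The elements of `Z` that some non-zero-divisor of `k` multiplies into `B`. -/
def saturation (Z B : Submodule k M) : Submodule k M :=
  Z ⊓ (Submodule.torsion k (M ⧸ B)).comap B.mkQ

theorem mem_saturation {Z B : Submodule k M} {z : M} :
    z ∈ saturation Z B ↔ z ∈ Z ∧ ∃ a ∈ nonZeroDivisors k, a • z ∈ B := by
  rw [saturation, Submodule.mem_inf, Submodule.mem_comap, Submodule.mem_torsion_iff]
  refine and_congr_right fun _ => ?_
  constructor
  · rintro ⟨⟨a, ha⟩, h⟩
    refine ⟨a, ha, ?_⟩
    rw [← Submodule.Quotient.mk_eq_zero]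
    exact h
  · rintro ⟨a, ha, h⟩
    refine ⟨⟨a, ha⟩, ?_⟩
    rw [← Submodule.Quotient.mk_eq_zero] at h
    exact h

theorem torsion_annihilator_iff {r : k} :
    (∀ x : Submodule.torsion k M, r • x = 0) ↔
      ∀ x : M, (∃ a ∈ nonZeroDivisors k, a • x = 0) → r • x = 0 := by
  rw [Subtype.forall]
  refine forall_congr' fun x => ?_
  constructor
  · rintro h ⟨a, ha, hx⟩
    exact congrArg Subtype.val (h ((Submodule.mem_torsion_iff x).2 ⟨⟨a, ha⟩, hx⟩))
  · intro h hx
    obtain ⟨⟨a, ha⟩, hx⟩ := (Submodule.mem_torsion_iff x).1 hx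
    exact Subtype.ext (h ⟨a, ha, hx⟩)

theorem nzdAnnihilator_congr (e : M ≃ₗ[k] N) : nzdAnnihilator k M = nzdAnnihilator k N := by
  have h : ∀ r : k, (∀ x : M, r • x = 0) ↔ ∀ x : N, r • x = 0 := fun r => by
    rw [e.surjective.forall]
    simp only [← map_smul, e.map_eq_zero_iff]
  simp only [nzdAnnihilator, h]

theorem exponent_torsion_congr {A A' : Type*} [AddCommGroup A] [AddCommGroup A'] (e : A ≃+ A') :
    AddMonoid.exponent (Submodule.torsion ℤ A) = AddMonoid.exponent (Submodule.torsion ℤ A') := by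
  refine exponent_eq_of_annihilator fun r => ?_
  rw [torsion_annihilator_iff, torsion_annihilator_iff, e.surjective.forall]
  simp only [← map_zsmul, e.map_eq_zero_iff]

theorem annihilator_torsion_subQuotient {Z B : Submodule k M} {r : k} :
    (∀ x : Submodule.torsion k (SubQuotient Z B), r • x = 0) ↔
      r ∈ colonIdeal (saturation Z B) B := by
  rw [torsion_annihilator_iff, mem_colonIdeal, (Submodule.mkQ_surjective (B.submoduleOf Z)).forall,
    Subtype.forall]
  have key : ∀ (z : M) (hz : z ∈ Z) (a : k),
      a • (B.submoduleOf Z).mkQ ⟨z, hz⟩ = 0 ↔ a • z ∈ B := by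
    intro z hz a
    rw [← map_smul, Submodule.mkQ_apply, Submodule.Quotient.mk_eq_zero]
    rfl
  simp only [key, mem_saturation, and_imp]

theorem finrank_subQuotient_add {K V : Type*} [Field K] [AddCommGroup V] [Module K V]
    [FiniteDimensional K V] {Z B : Submodule K V} (hBZ : B ≤ Z) :
    Module.finrank K (SubQuotient Z B) + Module.finrank K B = Module.finrank K Z := by
  rw [← (Submodule.submoduleOfEquivOfLe hBZ).finrank_eq]
  exact Submodule.finrank_quotient_add_finrank (R := K) (M := Z) _
end SubQuotient

/-! ### Stability of subquotients of free `OI`-modules -/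

section Stability
variable {X : FreeOISet}

theorem finrank_subQuotient_eventually_poly {K : Type*} [Field K] {D : ℕ}
    (hD : ∀ p, X.arity p ≤ D) {Z B : ∀ n, Submodule K (X.obj n →₀ K)} (hZ : IsOISubmodule X Z)
    (hB : IsOISubmodule X B) (hBZ : ∀ n, B n ≤ Z n) :
    ∃ p : Polynomial ℚ, p.natDegree ≤ D ∧ ∀ᶠ n : ℕ in Filter.atTop,
      FiniteDimensional K (SubQuotient (Z n) (B n)) ∧
        p.eval (n : ℚ) = (Module.finrank K (SubQuotient (Z n) (B n)) : ℚ) := by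
  obtain ⟨p, hp, hpe⟩ := finrank_eventually_poly hD hZ
  obtain ⟨q, hq, hqe⟩ := finrank_eventually_poly hD hB
  refine ⟨p - q, (Polynomial.natDegree_sub_le p q).trans (max_le hp hq), ?_⟩
  filter_upwards [hpe, hqe] with n hpn hqn
  refine ⟨inferInstance, ?_⟩
  rw [Polynomial.eval_sub, hpn, hqn, ← finrank_subQuotient_add (hBZ n)]
  push_cast
  ring

theorem nzdAnnihilator_eventually_const {k : Type*} [CommRing k] [IsNoetherianRing k]
    {Z B : ∀ n, Submodule k (X.obj n →₀ k)} (hZ : IsOISubmodule X Z) (hB : IsOISubmodule X B) :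
    ∃ I : Ideal k, ∀ᶠ n : ℕ in Filter.atTop, nzdAnnihilator k (SubQuotient (Z n) (B n)) = I := by
  obtain ⟨I, hI⟩ := colonIdeal_eventually_const hZ hB
  refine ⟨Ideal.span {r : k | r ∈ nonZeroDivisors k ∧ r ∈ I}, hI.mono fun n hn => ?_⟩
  simp only [nzdAnnihilator, annihilator_subQuotient, hn]

theorem exponent_eventually_const {Z B : ∀ n, Submodule ℤ (X.obj n →₀ ℤ)}
    (hZ : IsOISubmodule X Z) (hB : IsOISubmodule X B) :
    ∃ c : ℕ, ∀ᶠ n : ℕ in Filter.atTop, AddMonoid.exponent (SubQuotient (Z n) (B n)) = c := by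
  obtain ⟨I, hI⟩ := colonIdeal_eventually_const hZ hB
  obtain ⟨N, hN⟩ := Filter.eventually_atTop.1 hI
  refine ⟨AddMonoid.exponent (SubQuotient (Z N) (B N)), ?_⟩
  filter_upwards [Filter.eventually_ge_atTop N] with n hn
  refine exponent_eq_of_annihilator fun r => ?_
  rw [annihilator_subQuotient, annihilator_subQuotient, hN n hn, hN N le_rfl]

theorem IsOISubmodule.saturation {k : Type*} [CommRing k] {Z B : ∀ n, Submodule k (X.obj n →₀ k)}
    (hZ : IsOISubmodule X Z) (hB : IsOISubmodule X B) :
    IsOISubmodule X fun n => RackQuandle.saturation (Z n) (B n) := by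
  intro m n h w hw
  rw [mem_saturation] at hw ⊢
  obtain ⟨hw, a, ha, haw⟩ := hw
  refine ⟨hZ h w hw, a, ha, ?_⟩
  rw [← Finsupp.mapDomain_smul]
  exact hB h _ haw

/-- The torsion subgroup of a finitely generated abelian group is finite. -/
theorem exponent_torsion_pos (H : Type*) [AddCommGroup H] [Module.Finite ℤ H] :
    0 < AddMonoid.exponent (Submodule.torsion ℤ H) := by
  have : Finite (Submodule.torsion ℤ H) :=
    Module.finite_of_fg_torsion _ (Submodule.torsion_isTorsion)
  exact Nat.pos_of_ne_zero AddMonoid.exponent_ne_zero_of_finite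

theorem exponent_torsion_eventually_const {Z B : ∀ n, Submodule ℤ (X.obj n →₀ ℤ)}
    (hZ : IsOISubmodule X Z) (hB : IsOISubmodule X B) :
    ∃ c : ℕ, 0 < c ∧ ∀ᶠ n : ℕ in Filter.atTop,
      AddMonoid.exponent (Submodule.torsion ℤ (SubQuotient (Z n) (B n))) = c := by
  obtain ⟨I, hI⟩ := colonIdeal_eventually_const (hZ.saturation hB) hB
  obtain ⟨N, hN⟩ := Filter.eventually_atTop.1 hI
  refine ⟨AddMonoid.exponent (Submodule.torsion ℤ (SubQuotient (Z N) (B N))),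
    exponent_torsion_pos _, ?_⟩
  filter_upwards [Filter.eventually_ge_atTop N] with n hn
  refine exponent_eq_of_annihilator fun r => ?_
  rw [annihilator_torsion_subQuotient, annihilator_torsion_subQuotient, hN n hn, hN N le_rfl]

end Stability

/-! ### Functoriality of the rack complex -/

/-- A map of sets acts on tuples entrywise. -/
def tuplesMap {X Y : Type*} (φ : X → Y) : ∀ i, Tuples X i → Tuples Y i
  | 0 => PEmpty.elim
  | _ + 1 => fun v => φ ∘ v

section
variable (k : Type*) [CommRing k] {X Y : Type*}

theorem mapDomain_tup (φ : X → Y) {i : ℕ} (v : Fin (i + 1) → X) :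
    Finsupp.mapDomain (tuplesMap φ (i + 1)) (tup k v) = tup k (φ ∘ v) :=
  Finsupp.mapDomain_single

theorem comp_omitEntry (φ : X → Y) {i : ℕ} (v : Fin (i + 1) → X) (j : Fin (i + 1)) :
    φ ∘ omitEntry v j = omitEntry (φ ∘ v) j := by
  funext t
  simp only [omitEntry, Function.comp_apply]
  split_ifs <;> rfl

theorem comp_actEntry [Rack X] [Rack Y] {φ : X → Y} (hφ : ∀ x y, φ (rop x y) = rop (φ x) (φ y))
    {i : ℕ} (v : Fin (i + 1) → X) (j : Fin (i + 1)) :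
    φ ∘ actEntry v j = actEntry (φ ∘ v) j := by
  funext t
  simp only [actEntry, Function.comp_apply]
  split_ifs
  · exact hφ _ _
  · rfl

/-- Rack homomorphisms induce chain maps. -/
theorem rackBoundary_mapDomain [Rack X] [Rack Y] {φ : X → Y}
    (hφ : ∀ x y, φ (rop x y) = rop (φ x) (φ y)) (i : ℕ) (c : RackChain k X (i + 1)) :
    rackBoundary k Y i (Finsupp.mapDomain (tuplesMap φ (i + 1)) c) =
      Finsupp.mapDomain (tuplesMap φ i) (rackBoundary k X i c) := by
  suffices rackBoundary k Y i ∘ₗ Finsupp.lmapDomain k k (tuplesMap φ (i + 1)) =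
      Finsupp.lmapDomain k k (tuplesMap φ i) ∘ₗ rackBoundary k X i from LinearMap.congr_fun this c
  cases i with
  | zero => simp [rackBoundary]
  | succ i =>
    refine Finsupp.lhom_ext' fun v => LinearMap.ext_ring ?_
    change rackBoundary k Y (i + 1) (Finsupp.mapDomain _ (tup k (show Fin (i + 2) → X from v))) =
      Finsupp.lmapDomain k k (tuplesMap φ (i + 1))
        (rackBoundary k X (i + 1) (tup k (show Fin (i + 2) → X from v)))
    generalize (show Fin (i + 2) → X from v) = w
    rw [mapDomain_tup, rackBoundary_tup, rackBoundary_tup]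
    simp only [boundaryTuple, map_sum, map_smul, map_sub]
    refine Finset.sum_congr rfl fun j _ => ?_
    simp only [Finsupp.lmapDomain_apply, mapDomain_tup, comp_omitEntry, comp_actEntry hφ]

theorem mapDomain_mem_degenerate (φ : X → Y) {i : ℕ} {c : RackChain k X i}
    (hc : c ∈ degenerate k X i) : Finsupp.mapDomain (tuplesMap φ i) c ∈ degenerate k Y i := by
  suffices degenerate k X i ≤ (degenerate k Y i).comap (Finsupp.lmapDomain k k (tuplesMap φ i)) from
    this hc
  refine Submodule.span_le.2 ?_
  rintro _ ⟨v, hv, rfl⟩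
  refine Submodule.subset_span ⟨tuplesMap φ i v, ?_, Finsupp.mapDomain_single.symm⟩
  cases i with
  | zero => exact hv
  | succ i =>
    obtain ⟨j, hj⟩ := hv
    exact ⟨j, congrArg φ hj⟩
end

/-! ### Tuples of permutations -/

theorem viaEmbedding_trans {a b c : ℕ} (σ : Equiv.Perm (Fin a)) (f : Fin a ↪ Fin b)
    (g : Fin b ↪ Fin c) : σ.viaEmbedding (f.trans g) = (σ.viaEmbedding f).viaEmbedding g := by
  ext1 y
  by_cases hy : y ∈ Set.range g
  · obtain ⟨y, rfl⟩ := hy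
    rw [Equiv.Perm.viaEmbedding_apply]
    by_cases hy : y ∈ Set.range f
    · obtain ⟨x, rfl⟩ := hy
      rw [Equiv.Perm.viaEmbedding_apply]
      exact Equiv.Perm.viaEmbedding_apply σ (f.trans g) x
    · rw [Equiv.Perm.viaEmbedding_apply_of_notMem _ _ _ hy,
        Equiv.Perm.viaEmbedding_apply_of_notMem]
      rintro ⟨x, hx⟩
      exact hy ⟨x, g.injective hx⟩
  · rw [Equiv.Perm.viaEmbedding_apply_of_notMem _ _ _ hy,
      Equiv.Perm.viaEmbedding_apply_of_notMem]
    rintro ⟨x, rfl⟩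
    exact hy ⟨f x, rfl⟩

theorem cycleType_viaEmbedding {a b : ℕ} (σ : Equiv.Perm (Fin a)) (f : Fin a ↪ Fin b) :
    (σ.viaEmbedding f).cycleType = σ.cycleType := by
  let _ : DecidablePred fun y => y ∈ Set.range f.1 := fun y => Classical.propDecidable _
  exact Equiv.Perm.cycleType_extendDomain (Equiv.ofInjective f.1 f.2)

/-- A permutation that moves only points in the image of `f` comes from the domain of `f`. -/
theorem exists_viaEmbedding_eq {a b : ℕ} (σ : Equiv.Perm (Fin b)) (f : Fin a ↪ Fin b)
    (h : ∀ y, σ y ≠ y → y ∈ Set.range f) : ∃ τ : Equiv.Perm (Fin a), τ.viaEmbedding f = σ := by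
  have hr : ∀ x, ∃ t, f t = σ (f x) := by
    intro x
    by_contra hx
    refine hx ⟨x, (σ.injective ?_).symm⟩
    by_contra hne
    exact hx (h _ hne)
  choose t ht using hr
  have hinj : Function.Injective t := fun x y hxy =>
    f.injective (σ.injective (by rw [← ht, ← ht, hxy]))
  refine ⟨Equiv.ofBijective t (Finite.injective_iff_bijective.1 hinj), ?_⟩
  ext1 y
  by_cases hy : y ∈ Set.range f
  · obtain ⟨x, rfl⟩ := hy
    rw [Equiv.Perm.viaEmbedding_apply]
    exact ht x
  · rw [Equiv.Perm.viaEmbedding_apply_of_notMem _ _ _ hy]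
    by_contra hne
    exact hy (h y (Ne.symm hne))

theorem mem_conjClass_iff {l : Par} (hl : IsPrimitive l) {n : ℕ} {σ : Equiv.Perm (Fin n)} :
    σ ∈ conjClass l n ↔ σ.cycleType = l.2.parts := by
  have hfilter : ∀ r : ℕ, (l.2.parts + Multiset.replicate r 1).filter (2 ≤ ·) = l.2.parts := by
    intro r
    rw [Multiset.filter_add, Multiset.filter_eq_self.2, Multiset.filter_eq_nil.2, add_zero]
    · intro a ha
      rw [Multiset.eq_of_mem_replicate ha]
      omega
    · intro a ha
      have h0 := l.2.parts_pos ha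
      have h1 : a ≠ 1 := fun h => hl (h ▸ ha)
      omega
  have hsum : σ.cycleType = l.2.parts → σ.support.card = l.1 := by
    intro h
    rw [← Equiv.Perm.sum_cycleType, h, l.2.parts_sum]
  constructor
  · rintro ⟨-, h⟩
    rw [← Equiv.Perm.filter_parts_partition_eq_cycleType, h, hfilter]
  · intro h
    refine ⟨?_, ?_⟩
    · rw [← hsum h]
      simpa using Finset.card_le_univ σ.support
    · rw [Equiv.Perm.parts_partition, h, hsum h, Fintype.card_fin]

section SymClass
variable {Λ : Finset Par}

theorem mem_class_iff (hΛ : ∀ l ∈ Λ, IsPrimitive l) {n : ℕ} {σ : Equiv.Perm (Fin n)} :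
    (∃ l ∈ Λ, σ ∈ conjClass l n) ↔ ∃ l ∈ Λ, σ.cycleType = l.2.parts :=
  exists_congr fun l => and_congr_right fun hl => mem_conjClass_iff (hΛ l hl)

theorem viaEmbedding_mem_class_iff (hΛ : ∀ l ∈ Λ, IsPrimitive l) {a b : ℕ}
    {σ : Equiv.Perm (Fin a)} (f : Fin a ↪ Fin b) :
    (∃ l ∈ Λ, σ.viaEmbedding f ∈ conjClass l b) ↔ ∃ l ∈ Λ, σ ∈ conjClass l a := by
  rw [mem_class_iff hΛ, mem_class_iff hΛ, cycleType_viaEmbedding]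
end SymClass

/-! ### The free `OI`-set of tuples of permutations -/

section SymClass
variable {Λ : Finset Par} (hΛ : ∀ l ∈ Λ, IsPrimitive l)

instance finite_symClass (n : ℕ) : Finite (SymClass Λ n) :=
  inferInstanceAs (Finite {σ : Equiv.Perm (Fin n) // ∃ l ∈ Λ, σ ∈ conjClass l n})

/-- The map `c_Λ^m → c_Λ^n` that extends permutations by fixed points along `h`. -/
noncomputable def SymClass.extend {m n : ℕ} (h : Fin m ↪o Fin n) (σ : SymClass Λ m) :
    SymClass Λ n :=
  ⟨σ.1.viaEmbedding h.toEmbedding, (viaEmbedding_mem_class_iff hΛ _).2 σ.2⟩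

theorem SymClass.extend_rop {m n : ℕ} (h : Fin m ↪o Fin n) (σ τ : SymClass Λ m) :
    SymClass.extend hΛ h (rop σ τ) =
      rop (SymClass.extend hΛ h σ) (SymClass.extend hΛ h τ) := by
  apply Subtype.ext
  change Equiv.Perm.viaEmbedding (τ.1 * σ.1 * τ.1⁻¹) h.toEmbedding =
    τ.1.viaEmbedding h.toEmbedding * σ.1.viaEmbedding h.toEmbedding *
      (τ.1.viaEmbedding h.toEmbedding)⁻¹
  simp only [← Equiv.Perm.viaEmbeddingHom_apply, map_mul, map_inv]

theorem SymClass.extend_trans {l m n : ℕ} (g : Fin l ↪o Fin m) (h : Fin m ↪o Fin n)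
    (σ : SymClass Λ l) :
    SymClass.extend hΛ (g.trans h) σ = SymClass.extend hΛ h (SymClass.extend hΛ g σ) :=
  Subtype.ext (viaEmbedding_trans σ.1 g.toEmbedding h.toEmbedding)

theorem SymClass.extend_injective {m n : ℕ} (h : Fin m ↪o Fin n) :
    Function.Injective (SymClass.extend hΛ h) := fun _ _ hστ =>
  Subtype.ext (Equiv.Perm.viaEmbeddingHom_injective h.toEmbedding (congrArg Subtype.val hστ))

/-- The points moved by some entry of a tuple of permutations. -/
def movedSet {n i : ℕ} (v : Fin i → SymClass Λ n) : Set (Fin n) :=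
  {x | ∃ j, (v j).1 x ≠ x}

theorem movedSet_extend {m n i : ℕ} (h : Fin m ↪o Fin n) (v : Fin i → SymClass Λ m) :
    movedSet (SymClass.extend hΛ h ∘ v) = h '' movedSet v := by
  ext y
  constructor
  · rintro ⟨j, hj⟩
    by_cases hy : y ∈ Set.range h
    · obtain ⟨x, rfl⟩ := hy
      refine ⟨x, ⟨j, fun hx => hj ?_⟩, rfl⟩
      exact (Equiv.Perm.viaEmbedding_apply (v j).1 h.toEmbedding x).trans (congrArg h hx)
    · exact (hj (Equiv.Perm.viaEmbedding_apply_of_notMem _ _ _ hy)).elim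
  · rintro ⟨x, ⟨j, hj⟩, rfl⟩
    refine ⟨j, fun hx => hj (h.injective ?_)⟩
    exact (Equiv.Perm.viaEmbedding_apply (v j).1 h.toEmbedding x).symm.trans hx

theorem ncard_movedSet_le (hΛ : ∀ l ∈ Λ, IsPrimitive l) {n i : ℕ} (v : Fin i → SymClass Λ n) :
    (movedSet v).ncard ≤ i * parSize Λ := by
  have hsub : movedSet v ⊆ ((Finset.univ.biUnion fun j => (v j).1.support : Finset (Fin n)) :
      Set (Fin n)) := by
    rintro x ⟨j, hj⟩
    simp only [Finset.coe_biUnion, Finset.coe_univ, Set.mem_iUnion]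
    exact ⟨j, trivial, by simpa using hj⟩
  refine (Set.ncard_le_ncard hsub (Finset.finite_toSet _)).trans ?_
  rw [Set.ncard_coe_finset]
  refine (Finset.card_biUnion_le_card_mul _ _ (parSize Λ) fun j _ => ?_).trans (by simp)
  obtain ⟨l, hl, hσ⟩ := (mem_class_iff hΛ).1 (v j).2
  rw [← Equiv.Perm.sum_cycleType, hσ, l.2.parts_sum]
  exact Finset.le_sup (f := fun l : Par => l.1) hl

/-- The generators of the `OI`-set of `i`-tuples: tuples of permutations of `Fin d` without
common fixed point, where `d ≤ i * |Λ|`. As the complex is zero in degree `0`, there are none for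
`i = 0`. -/
def TupleGen (Λ : Finset Par) : ℕ → Type
  | 0 => PEmpty
  | i + 1 => Σ d : Fin ((i + 1) * parSize Λ + 1),
      {w : Fin (i + 1) → SymClass Λ d // movedSet w = Set.univ}

instance finite_tupleGen : ∀ i, Finite (TupleGen Λ i)
  | 0 => inferInstanceAs (Finite PEmpty)
  | i + 1 => inferInstanceAs (Finite (Σ d : Fin ((i + 1) * parSize Λ + 1),
      {w : Fin (i + 1) → SymClass Λ d // movedSet w = Set.univ}))

/-- The number of points permuted by a generator. -/
def TupleGen.arity : ∀ {i}, TupleGen Λ i → ℕ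
  | 0, p => PEmpty.elim p
  | _ + 1, p => p.1

theorem TupleGen.arity_le : ∀ {i} (p : TupleGen Λ i), p.arity ≤ i * parSize Λ
  | 0, p => PEmpty.elim p
  | _ + 1, p => Nat.le_of_lt_succ p.1.2

/-- A generator as a tuple. -/
def TupleGen.tuple : ∀ {i} (p : TupleGen Λ i), Tuples (SymClass Λ p.arity) i
  | 0, p => PEmpty.elim p
  | _ + 1, p => p.2.1

/-- A tuple determines the generator and the embedding it comes from: the range of the embedding is
the set of the points moved by the tuple. -/
theorem extend_tuple_injective {i n d d' : ℕ} {w : Fin i → SymClass Λ d}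
    {w' : Fin i → SymClass Λ d'} (hw : movedSet w = Set.univ) (hw' : movedSet w' = Set.univ)
    {f : Fin d ↪o Fin n} {f' : Fin d' ↪o Fin n}
    (h : SymClass.extend hΛ f ∘ w = SymClass.extend hΛ f' ∘ w') :
    ∃ hd : d = d', hd ▸ w = w' ∧ hd ▸ f = f' := by
  have hr : Set.range f = Set.range f' := by
    have := congrArg movedSet h
    rwa [movedSet_extend, movedSet_extend, hw, hw', Set.image_univ, Set.image_univ] at this
  obtain rfl : d = d' := by
    have := congrArg Set.ncard hr
    rwa [← Nat.card_coe_set_eq, ← Nat.card_coe_set_eq, Nat.card_range_of_injective f.injective,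
      Nat.card_range_of_injective f'.injective, Nat.card_fin, Nat.card_fin] at this
  obtain rfl := OrderEmbedding.range_inj.1 hr
  exact ⟨rfl, (SymClass.extend_injective hΛ f).comp_left h, rfl⟩

/-- Every tuple comes from a generator, by restriction to the points that it moves. -/
theorem exists_extend_tuple_eq {i n : ℕ} (v : Fin i → SymClass Λ n) :
    ∃ d ≤ i * parSize Λ, ∃ w : Fin i → SymClass Λ d, movedSet w = Set.univ ∧
      ∃ f : Fin d ↪o Fin n, SymClass.extend hΛ f ∘ w = v := by
  classical
  let S : Finset (Fin n) := (Set.toFinite (movedSet v)).toFinset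
  have hS : (S : Set (Fin n)) = movedSet v := Set.Finite.coe_toFinset _
  let f : Fin S.card ↪o Fin n := S.orderEmbOfFin rfl
  have hf : Set.range f = movedSet v := by rw [← hS]; exact S.range_orderEmbOfFin rfl
  choose τ hτ using fun j => exists_viaEmbedding_eq (v j).1 f.toEmbedding
    fun y hy => (hf ▸ (⟨j, hy⟩ : y ∈ movedSet v) : y ∈ Set.range f)
  let w : Fin i → SymClass Λ S.card := fun j =>
    ⟨τ j, (viaEmbedding_mem_class_iff hΛ f.toEmbedding).1 (by rw [hτ]; exact (v j).2)⟩
  have hw : SymClass.extend hΛ f ∘ w = v := funext fun j => Subtype.ext (hτ j)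
  refine ⟨S.card, ?_, w, ?_, f, hw⟩
  · rw [← Set.ncard_coe_finset, hS]
    exact ncard_movedSet_le hΛ v
  · have := movedSet_extend hΛ f w
    rw [hw, ← hf, ← Set.image_univ] at this
    exact (f.injective.image_injective this).symm

theorem bijective_extend_tuple (n : ℕ) : ∀ i, Function.Bijective
    (fun y : Σ p : TupleGen Λ i, (Fin p.arity ↪o Fin n) =>
      tuplesMap (SymClass.extend hΛ y.2) i y.1.tuple)
  | 0 => ⟨fun y => PEmpty.elim y.1, fun v => PEmpty.elim v⟩
  | i + 1 => by
    constructor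
    · rintro ⟨⟨⟨d, hd⟩, w, hw⟩, f⟩ ⟨⟨⟨d', hd'⟩, w', hw'⟩, f'⟩ h
      obtain ⟨hdd, h1, h2⟩ := extend_tuple_injective hΛ hw hw' h
      simp only at hdd
      subst hdd
      subst h1
      subst h2
      rfl
    · intro v
      obtain ⟨d, hd, w, hw, f, hv⟩ := exists_extend_tuple_eq hΛ
        (show Fin (i + 1) → SymClass Λ n from v)
      exact ⟨⟨⟨⟨d, Nat.lt_succ_of_le hd⟩, w, hw⟩, f⟩, hv⟩

theorem tuplesMap_comp {X Y Z : Type*} (φ : X → Y) (ψ : Y → Z) :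
    ∀ i (v : Tuples X i), tuplesMap (ψ ∘ φ) i v = tuplesMap ψ i (tuplesMap φ i v)
  | 0, v => PEmpty.elim v
  | _ + 1, _ => rfl

/-- The `i`-tuples of permutations in `c_Λ^n` form a finitely generated free `OI`-set: each tuple is
transported from the set of the points it moves. -/
noncomputable abbrev tupleOISet (i : ℕ) : FreeOISet where
  obj n := Tuples (SymClass Λ n) i
  map h := tuplesMap (SymClass.extend hΛ h) i
  Gen := TupleGen Λ i
  arity := TupleGen.arity
  decomp n := (Equiv.ofBijective _ (bijective_extend_tuple hΛ n i)).symm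
  decomp_map {m n} h x := by
    rw [Equiv.symm_apply_eq]
    obtain ⟨y, rfl⟩ := (bijective_extend_tuple hΛ m i).2 x
    rw [Equiv.ofBijective_symm_apply_apply _ (bijective_extend_tuple hΛ m i)]
    rw [← tuplesMap_comp]
    exact congrArg (fun φ => tuplesMap φ i y.1.tuple)
      (funext fun σ => (SymClass.extend_trans hΛ y.2 h σ).symm)

/-! ### Cycles and boundaries as `OI`-submodules -/

section Submodules
variable (k : Type*) [CommRing k] (i : ℕ)

theorem isOISubmodule_rackCycles :
    IsOISubmodule (tupleOISet hΛ i) fun n => rackCycles k (SymClass Λ n) i := by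
  intro m n h w hw
  cases i with
  | zero => trivial
  | succ i =>
    have hw' : rackBoundary k _ i w = 0 := hw
    change rackBoundary k _ i _ = 0
    refine (rackBoundary_mapDomain k (SymClass.extend_rop hΛ h) i w).trans ?_
    rw [hw', Finsupp.mapDomain_zero]

theorem isOISubmodule_rackBoundaries :
    IsOISubmodule (tupleOISet hΛ i) fun n =>
      LinearMap.range (rackBoundary k (SymClass Λ n) i) := by
  rintro m n h _ ⟨c, rfl⟩
  exact ⟨_, rackBoundary_mapDomain k (SymClass.extend_rop hΛ h) i c⟩

theorem rackBoundaries_le (X : Type*) [Rack X] :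
    LinearMap.range (rackBoundary k X i) ≤ rackCycles k X i := by
  cases i with
  | zero => exact le_top
  | succ i => exact LinearMap.range_le_ker_iff.2 (rackBoundary_comp k X i)

theorem quandleBoundaries_le (X : Type*) [Quandle X] :
    LinearMap.range (quandleBoundary k X i) ≤ quandleCycles k X i := by
  cases i with
  | zero => exact le_top
  | succ i => exact LinearMap.range_le_ker_iff.2 (quandleBoundary_comp k X i)

theorem isOISubmodule_quandleCycles :
    IsOISubmodule (tupleOISet hΛ i) fun n =>
      (quandleCycles k (SymClass Λ n) i).comap (degenerate k (SymClass Λ n) i).mkQ := by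
  intro m n h w hw
  cases i with
  | zero => trivial
  | succ i =>
    have hmem : ∀ {n} (c : RackChain k (SymClass Λ n) (i + 1)),
        c ∈ (quandleCycles k (SymClass Λ n) (i + 1)).comap (degenerate k _ (i + 1)).mkQ ↔
          rackBoundary k _ i c ∈ degenerate k _ i := fun c => by
      exact Submodule.Quotient.mk_eq_zero _
    refine (hmem _).2 ?_
    have := mapDomain_mem_degenerate k (SymClass.extend hΛ h) ((hmem w).1 hw)
    rwa [← rackBoundary_mapDomain k (SymClass.extend_rop hΛ h)] at this

theorem isOISubmodule_quandleBoundaries :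
    IsOISubmodule (tupleOISet hΛ i) fun n =>
      (LinearMap.range (quandleBoundary k (SymClass Λ n) i)).comap
        (degenerate k (SymClass Λ n) i).mkQ := by
  intro m n h w hw
  have hmem : ∀ {n} (c : RackChain k (SymClass Λ n) i),
      c ∈ (LinearMap.range (quandleBoundary k (SymClass Λ n) i)).comap (degenerate k _ i).mkQ ↔
        ∃ b, rackBoundary k _ i b - c ∈ degenerate k _ i := fun c => by
    rw [Submodule.mem_comap, LinearMap.mem_range, (Submodule.mkQ_surjective _).exists]
    refine exists_congr fun b => ?_
    exact Submodule.Quotient.eq _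
  obtain ⟨b, hb⟩ := (hmem w).1 hw
  refine (hmem _).2 ⟨Finsupp.mapDomain (tuplesMap (SymClass.extend hΛ h) (i + 1)) b, ?_⟩
  rw [rackBoundary_mapDomain k (SymClass.extend_rop hΛ h)]
  have := mapDomain_mem_degenerate k (SymClass.extend hΛ h) hb
  have hsub := map_sub (Finsupp.lmapDomain k k (tuplesMap (SymClass.extend hΛ h) i))
    (rackBoundary k _ i b) w
  simp only [Finsupp.lmapDomain_apply] at hsub
  rwa [hsub] at this

/-- Quandle homology as a subquotient of the rack chains. -/
noncomputable def quandleHomologyEquiv (X : Type*) [Quandle X] :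
    QuandleHomology k X i ≃ₗ[k]
      SubQuotient ((quandleCycles k X i).comap (degenerate k X i).mkQ)
        ((LinearMap.range (quandleBoundary k X i)).comap (degenerate k X i).mkQ) :=
  (subQuotientComapEquiv _ (Submodule.mkQ_surjective _) _ _).symm

end Submodules
end SymClass
end RackQuandle

theorem corollary3p2 (Λ : Finset Par)
    (hΛ : ∀ l ∈ Λ, IsPrimitive l) (i : ℕ) :
    -- over a field, the dimensions are eventually polynomial of degree at most `i * |Λ|`
    (∀ (k : Type u) [Field k],
      (∃ p : Polynomial ℚ, p.natDegree ≤ i * parSize Λ ∧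
        ∀ᶠ n : ℕ in Filter.atTop,
          FiniteDimensional k
            (RackHomology k (SymClass Λ n) i) ∧
          p.eval (n : ℚ) = (Module.finrank k
            (RackHomology k (SymClass Λ n) i) : ℚ)) ∧
      (∃ p : Polynomial ℚ, p.natDegree ≤ i * parSize Λ ∧
        ∀ᶠ n : ℕ in Filter.atTop,
          FiniteDimensional k
            (QuandleHomology k (SymClass Λ n) i) ∧
          p.eval (n : ℚ) = (Module.finrank k
            (QuandleHomology k (SymClass Λ n) i) : ℚ))) ∧
    -- over a Noetherian ring, the ideals are eventually independent of `n`
    (∀ (k : Type u) [CommRing k] [IsNoetherianRing k],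
      (∃ I : Ideal k, ∀ᶠ n : ℕ in Filter.atTop,
        nzdAnnihilator k
          (RackHomology k (SymClass Λ n) i) = I) ∧
      (∃ I : Ideal k, ∀ᶠ n : ℕ in Filter.atTop,
        nzdAnnihilator k
          (QuandleHomology k (SymClass Λ n) i) = I)) ∧
    -- over `ℤ`, the exponent (`0` if no positive integer annihilates the group) stabilizes
    (∃ e : ℕ, ∀ᶠ n : ℕ in Filter.atTop,
      AddMonoid.exponent
        (RackHomology ℤ (SymClass Λ n) i) = e) ∧
    (∃ e : ℕ, ∀ᶠ n : ℕ in Filter.atTop,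
      AddMonoid.exponent
        (QuandleHomology ℤ (SymClass Λ n) i) = e) ∧
    -- so does the exponent of the torsion subgroup, which is positive
    (∃ e : ℕ, 0 < e ∧ ∀ᶠ n : ℕ in Filter.atTop,
      AddMonoid.exponent (Submodule.torsion ℤ
        (RackHomology ℤ (SymClass Λ n) i)) = e) ∧
    (∃ e : ℕ, 0 < e ∧ ∀ᶠ n : ℕ in Filter.atTop,
      AddMonoid.exponent (Submodule.torsion ℤ
        (QuandleHomology ℤ (SymClass Λ n) i)) = e) := by
  refine ⟨fun k _ => ⟨?_, ?_⟩, fun k _ _ => ⟨?_, ?_⟩, ?_, ?_, ?_, ?_⟩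
  · exact finrank_subQuotient_eventually_poly (X := tupleOISet hΛ i) TupleGen.arity_le
      (isOISubmodule_rackCycles hΛ k i) (isOISubmodule_rackBoundaries hΛ k i)
      fun n => rackBoundaries_le k i _
  · obtain ⟨p, hp, hev⟩ := finrank_subQuotient_eventually_poly (X := tupleOISet hΛ i)
      TupleGen.arity_le (isOISubmodule_quandleCycles hΛ k i)
      (isOISubmodule_quandleBoundaries hΛ k i)
      fun n => Submodule.comap_mono (quandleBoundaries_le k i _)
    exact ⟨p, hp, hev.mono fun n ⟨_, h⟩ =>
      ⟨Module.Finite.equiv (quandleHomologyEquiv k i _).symm,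
        h.trans (congrArg _ (quandleHomologyEquiv k i _).finrank_eq.symm)⟩⟩
  · exact nzdAnnihilator_eventually_const (X := tupleOISet hΛ i)
      (isOISubmodule_rackCycles hΛ k i) (isOISubmodule_rackBoundaries hΛ k i)
  · obtain ⟨I, hI⟩ := nzdAnnihilator_eventually_const (X := tupleOISet hΛ i)
      (isOISubmodule_quandleCycles hΛ k i) (isOISubmodule_quandleBoundaries hΛ k i)
    exact ⟨I, hI.mono fun n h => (nzdAnnihilator_congr (quandleHomologyEquiv k i _)).trans h⟩
  · exact exponent_eventually_const (X := tupleOISet hΛ i)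
      (isOISubmodule_rackCycles hΛ ℤ i) (isOISubmodule_rackBoundaries hΛ ℤ i)
  · obtain ⟨e, he⟩ := exponent_eventually_const (X := tupleOISet hΛ i)
      (isOISubmodule_quandleCycles hΛ ℤ i) (isOISubmodule_quandleBoundaries hΛ ℤ i)
    exact ⟨e, he.mono fun n h =>
      (AddMonoid.exponent_eq_of_addEquiv (quandleHomologyEquiv ℤ i _).toAddEquiv).trans h⟩
  · exact exponent_torsion_eventually_const (X := tupleOISet hΛ i)
      (isOISubmodule_rackCycles hΛ ℤ i) (isOISubmodule_rackBoundaries hΛ ℤ i)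
  · obtain ⟨e, he0, he⟩ := exponent_torsion_eventually_const (X := tupleOISet hΛ i)
      (isOISubmodule_quandleCycles hΛ ℤ i) (isOISubmodule_quandleBoundaries hΛ ℤ i)
    exact ⟨e, he0, he.mono fun n h =>
      (exponent_torsion_congr (quandleHomologyEquiv ℤ i _).toAddEquiv).trans h⟩
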